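/- All vector spaces are complex. An operator space matrix norm on a vector space $E$ is a family of norms on the matrix spaces $M_n(E)$, $n\in\mathbb N$, with $\|v\oplus w\|=\max\{\|v\|,\|w\|\}$ and $\|\alpha v\beta\|\le\|\alpha\|\,\|v\|\,\|\beta\|$ for scalar matrices $\alpha,\beta$; an operator space is a vector space with such a matrix norm. Let $V,W,X,Y,U_1,U_2$ denote operator spaces that are complete. For a bilinear map $\phi:V\times W\to X$, $v\in M_n(V)$ and $w\in M_n(W)$ put $\phi_n(v,w)=(\phi(v_{ij},w_{kl}))\in M_{n^2}(X)$ and $\phi_{(n)}(v,w)=\big(\sum_k\phi(v_{ik},w_{kl})\big)_{i,l}\in M_n(X)$. Let $\mathcal{JCB}(V\times W,X)$ be the space of those $\phi$ with $\|\phi\|_{jcb}=\sup_n\|\phi_n\|<\infty$, and $\mathcal{MB}(V\times W,X)$ the space of those with $\|\phi\|_{mb}=\sup_n\|\phi_{(n)}\|<\infty$; they carry the matrix norms given by $M_n(\mathcal{JCB}(V\times W,X))=\mathcal{JCB}(V\times W,M_n(X))$ and $M_n(\mathcal{MB}(V\times W,X))=\mathcal{MB}(V\times W,M_n(X))$. Put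 $\phi^t(w,v)=\phi(v,w)$, and let ${}^t\mathcal{MB}(W\times V,X)$ be the space of all $\phi:V\times W\to X$ with $\phi^t\in\mathcal{MB}(W\times V,X)$, with the matrix norm of $\phi^t$. Let $\mathcal{SMB}(V\times W,X)$ be the space of all sums $\phi_1+\phi_2$ with $\phi_1\in\mathcal{MB}(V\times W,X)$ and $\phi_2\in{}^t\mathcal{MB}(W\times V,X)$, with, for $\phi\in M_n(\mathcal{SMB}(V\times W,X))$, $$\|\phi\|_{smb}=\inf\left\{\|(\phi_1,\phi_2)\|_{M_n(\mathcal{MB}(V\times W,X)\oplus_1{}^t\mathcal{MB}(W\times V,X))}:\ \phi=\phi_1+\phi_2\right\}.$$ Here the matrix norm of an $\ell_1$-direct sum $E\oplus_1F$ is $\|(x,y)\|_{M_n(E\oplus_1F)}=\sup\|f_n(x)+g_n(y)\|$, over all pairs of complete contractions $f:E\to Z$, $g:F\to Z$ into a common operator space $Z$. Then $\mathcal{SMB}$ is a symmetric operator space bilinear ideal, that is, for all $V,W,X$: 1. $\mathcal{SMB}(V\times W,X)$ is a linear subspace of $\mathcal{JCB}(V\times W,X)$ that contains all finite type continuous bilinear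 maps (finite sums of maps $(v,w)\mapsto f(v)g(w)x$ with $f\in V^*$, $g\in W^*$, $x\in X$), and $\|\cdot\|_{smb}$ is an operator space matrix norm on it; 2. $\|\phi\|_{jcb}\le\|\phi\|_{smb}$ for all $n$ and all $\phi\in M_n(\mathcal{SMB}(V\times W,X))$; 3. for all $n$, all $\phi\in M_n(\mathcal{SMB}(V\times W,X))$ and all completely bounded linear maps $r_1:U_1\to V$, $r_2:U_2\to W$, $s:X\to Y$, the matrix $s_n\circ\phi\circ(r_1,r_2)$ belongs to $M_n(\mathcal{SMB}(U_1\times U_2,Y))$ and $\|s_n\circ\phi\circ(r_1,r_2)\|_{smb}\le\|s\|_{cb}\,\|\phi\|_{smb}\,\|r_1\|_{cb}\,\|r_2\|_{cb}$; 4. if $\phi\in\mathcal{SMB}(V\times W,X)$, then $\phi^t\in\mathcal{SMB}(W\times V,X)$ and $\|\phi^t\|_{smb}=\|\phi\|_{smb}$. -/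

import Mathlib

universe u

noncomputable section

namespace OpSp

/-! ### Matrix norms and operator spaces -/

/-- A family of real-valued functions `mnorm n` on the spaces `M_n(E)`. -/
class MatrixNorm (E : Type*) where
  mnorm : ∀ n : ℕ, Matrix (Fin n) (Fin n) E → ℝ

/-- The norm of a scalar matrix `α ∈ M_{m × n}`, as an operator from `ℓ₂ⁿ` to `ℓ₂ᵐ`. -/
def scalarNorm {m n : ℕ} (α : Matrix (Fin m) (Fin n) ℂ) : ℝ :=
  ‖(Matrix.toEuclideanLin α).toContinuousLinearMap‖

/-- The product `α v β` of scalar matrices with a matrix `v` of vectors. -/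
def sandwich {E : Type*} [AddCommGroup E] [Module ℂ E] {m n : ℕ}
    (α : Matrix (Fin m) (Fin n) ℂ) (v : Matrix (Fin n) (Fin n) E)
    (β : Matrix (Fin n) (Fin m) ℂ) : Matrix (Fin m) (Fin m) E :=
  Matrix.of fun i j => ∑ k, ∑ l, (α i k * β l j) • v k l

/-- The block diagonal matrix `v ⊕ w ∈ M_{n+m}(E)`. -/
def directSum {E : Type*} [AddCommGroup E] {n m : ℕ}
    (v : Matrix (Fin n) (Fin n) E) (w : Matrix (Fin m) (Fin m) E) :
    Matrix (Fin (n + m)) (Fin (n + m)) E :=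
  Matrix.reindex finSumFinEquiv finSumFinEquiv (Matrix.fromBlocks v 0 0 w)

/-- `N` is an operator space matrix norm on `E`: each `N n` is a norm on `M_n(E)`, and the
axioms (M1) and (M2) hold. -/
structure IsOperatorSpaceNorm {E : Type*} [AddCommGroup E] [Module ℂ E]
    (N : ∀ n : ℕ, Matrix (Fin n) (Fin n) E → ℝ) : Prop where
  nonneg : ∀ (n : ℕ) (v : Matrix (Fin n) (Fin n) E), 0 ≤ N n v
  eq_zero : ∀ (n : ℕ) (v : Matrix (Fin n) (Fin n) E), N n v = 0 → v = 0
  smul_eq : ∀ (n : ℕ) (c : ℂ) (v : Matrix (Fin n) (Fin n) E), N n (c • v) = ‖c‖ * N n v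
  add_le : ∀ (n : ℕ) (v w : Matrix (Fin n) (Fin n) E), N n (v + w) ≤ N n v + N n w
  direct_sum : ∀ (n m : ℕ) (v : Matrix (Fin n) (Fin n) E) (w : Matrix (Fin m) (Fin m) E),
    N (n + m) (directSum v w) = max (N n v) (N m w)
  sandwich_le : ∀ (n m : ℕ) (α : Matrix (Fin m) (Fin n) ℂ) (v : Matrix (Fin n) (Fin n) E)
    (β : Matrix (Fin n) (Fin m) ℂ),
    N m (sandwich α v β) ≤ scalarNorm α * N n v * scalarNorm β

/-- An operator space; its norm as a normed space is the norm of `M_1(V) = V`. -/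
class OperatorSpace (V : Type*) extends NormedAddCommGroup V, NormedSpace ℂ V,
    MatrixNorm V where
  isOperatorSpaceNorm : IsOperatorSpaceNorm mnorm
  mnorm_one : ∀ v : V, mnorm 1 (Matrix.of fun _ _ => v) = ‖v‖

open MatrixNorm

/-- The matrix norm of `M_n(X)`, through `M_m(M_n(X)) = M_{mn}(X)`. -/
instance matrixMatrixNorm (X : Type*) [MatrixNorm X] (n : ℕ) :
    MatrixNorm (Matrix (Fin n) (Fin n) X) where
  mnorm m y := mnorm (m * n) (Matrix.reindex finProdFinEquiv finProdFinEquiv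
    (Matrix.of fun p q : Fin m × Fin n => y p.1 q.1 p.2 q.2))

/-! ### Completely bounded linear maps -/

section Linear

variable {E F : Type*} [AddCommGroup E] [Module ℂ E] [MatrixNorm E]
  [AddCommGroup F] [Module ℂ F] [MatrixNorm F]

/-- The values `‖r_n(v)‖`, for `n ∈ ℕ` and `v` in the closed unit ball of `M_n(E)`. -/
def cbValues (r : E →ₗ[ℂ] F) : Set ℝ :=
  {t | ∃ (n : ℕ) (v : Matrix (Fin n) (Fin n) E), mnorm n v ≤ 1 ∧ t = mnorm n (v.map r)}

def IsCB (r : E →ₗ[ℂ] F) : Prop := BddAbove (cbValues r)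

/-- `‖r‖_cb = sup_n ‖r_n‖` (meaningful when `r` is completely bounded). -/
def cbNorm (r : E →ₗ[ℂ] F) : ℝ := sSup (cbValues r)

def IsCompleteContraction (r : E →ₗ[ℂ] F) : Prop := IsCB r ∧ cbNorm r ≤ 1

end Linear

/-! ### Jointly completely bounded and multiplicatively bounded bilinear maps -/

section Bilinear

variable {V W X : Type*} [AddCommGroup V] [Module ℂ V] [AddCommGroup W] [Module ℂ W]
  [AddCommGroup X] [Module ℂ X]

/-- `φ_n(v, w) = (φ(v_{ij}, w_{kl})) ∈ M_{n²}(X)`, with rows `(i, k)` and columns `(j, l)`. -/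
def jointAmp (φ : V →ₗ[ℂ] W →ₗ[ℂ] X) (n : ℕ) (v : Matrix (Fin n) (Fin n) V)
    (w : Matrix (Fin n) (Fin n) W) : Matrix (Fin (n * n)) (Fin (n * n)) X :=
  Matrix.reindex finProdFinEquiv finProdFinEquiv
    (Matrix.of fun p q : Fin n × Fin n => φ (v p.1 q.1) (w p.2 q.2))

/-- `φ_(n)(v, w) = (∑_k φ(v_{ik}, w_{kl})) ∈ M_n(X)`. -/
def multAmp (φ : V →ₗ[ℂ] W →ₗ[ℂ] X) (n : ℕ) (v : Matrix (Fin n) (Fin n) V)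
    (w : Matrix (Fin n) (Fin n) W) : Matrix (Fin n) (Fin n) X :=
  Matrix.of fun i l => ∑ k, φ (v i k) (w k l)

/-- The bilinear map `V × W → M_n(X)` given by a matrix of bilinear maps `V × W → X`. -/
def assemble {n : ℕ} (φ : Matrix (Fin n) (Fin n) (V →ₗ[ℂ] W →ₗ[ℂ] X)) :
    V →ₗ[ℂ] W →ₗ[ℂ] Matrix (Fin n) (Fin n) X :=
  LinearMap.mk₂ ℂ (fun v w => Matrix.of fun i j => φ i j v w)
    (fun _ _ _ => by ext; simp) (fun _ _ _ => by ext; simp)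
    (fun _ _ _ => by ext; simp) (fun _ _ _ => by ext; simp)

variable [MatrixNorm V] [MatrixNorm W] [MatrixNorm X]

/-- The values `‖φ_n(v, w)‖`, for `n ∈ ℕ` and `v`, `w` in the closed unit balls. -/
def jcbValues (φ : V →ₗ[ℂ] W →ₗ[ℂ] X) : Set ℝ :=
  {t | ∃ (n : ℕ) (v : Matrix (Fin n) (Fin n) V) (w : Matrix (Fin n) (Fin n) W),
    mnorm n v ≤ 1 ∧ mnorm n w ≤ 1 ∧ t = mnorm (n * n) (jointAmp φ n v w)}

def IsJCB (φ : V →ₗ[ℂ] W →ₗ[ℂ] X) : Prop := BddAbove (jcbValues φ)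

/-- `‖φ‖_jcb = sup_n ‖φ_n‖` (meaningful when `φ` is jointly completely bounded). -/
def jcbNorm (φ : V →ₗ[ℂ] W →ₗ[ℂ] X) : ℝ := sSup (jcbValues φ)

/-- The values `‖φ_(n)(v, w)‖`, for `n ∈ ℕ` and `v`, `w` in the closed unit balls. -/
def mbValues (φ : V →ₗ[ℂ] W →ₗ[ℂ] X) : Set ℝ :=
  {t | ∃ (n : ℕ) (v : Matrix (Fin n) (Fin n) V) (w : Matrix (Fin n) (Fin n) W),
    mnorm n v ≤ 1 ∧ mnorm n w ≤ 1 ∧ t = mnorm n (multAmp φ n v w)}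

def IsMB (φ : V →ₗ[ℂ] W →ₗ[ℂ] X) : Prop := BddAbove (mbValues φ)

/-- `‖φ‖_mb = sup_n ‖φ_(n)‖` (meaningful when `φ` is multiplicatively bounded). -/
def mbNorm (φ : V →ₗ[ℂ] W →ₗ[ℂ] X) : ℝ := sSup (mbValues φ)

/-- The norm of `M_n(JCB(V × W, X)) = JCB(V × W, M_n(X))`. -/
def jcbMatrixNorm (n : ℕ) (φ : Matrix (Fin n) (Fin n) (V →ₗ[ℂ] W →ₗ[ℂ] X)) : ℝ :=
  jcbNorm (assemble φ)

/-- The norm of `M_n(MB(V × W, X)) = MB(V × W, M_n(X))`. -/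
def mbMatrixNorm (n : ℕ) (φ : Matrix (Fin n) (Fin n) (V →ₗ[ℂ] W →ₗ[ℂ] X)) : ℝ :=
  mbNorm (assemble φ)

end Bilinear

section Spaces

variable (V W X : Type u) [OperatorSpace V] [OperatorSpace W] [OperatorSpace X]

/-- The space `MB(V × W, X)` of multiplicatively bounded bilinear maps. -/
def MB : Submodule ℂ (V →ₗ[ℂ] W →ₗ[ℂ] X) where
  carrier := {φ | IsMB φ}
  zero_mem' := by
    refine ⟨0, ?_⟩
    rintro t ⟨n, v, w, -, -, rfl⟩
    have h0 : multAmp (0 : V →ₗ[ℂ] W →ₗ[ℂ] X) n v w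
        = (0 : ℂ) • (0 : Matrix (Fin n) (Fin n) X) := by
      ext; simp [multAmp]
    rw [h0, OperatorSpace.isOperatorSpaceNorm.smul_eq]
    simp
  add_mem' := by
    rintro φ ψ ⟨a, ha⟩ ⟨b, hb⟩
    refine ⟨a + b, ?_⟩
    rintro t ⟨n, v, w, hv, hw, rfl⟩
    have h0 : multAmp (φ + ψ) n v w = multAmp φ n v w + multAmp ψ n v w := by
      ext; simp [multAmp, Finset.sum_add_distrib]
    rw [h0]
    exact (OperatorSpace.isOperatorSpaceNorm.add_le n _ _).trans
      (add_le_add (ha ⟨n, v, w, hv, hw, rfl⟩) (hb ⟨n, v, w, hv, hw, rfl⟩))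
  smul_mem' := by
    rintro c φ ⟨a, ha⟩
    refine ⟨‖c‖ * a, ?_⟩
    rintro t ⟨n, v, w, hv, hw, rfl⟩
    have h0 : multAmp (c • φ) n v w = c • multAmp φ n v w := by
      ext; simp [multAmp, Finset.smul_sum]
    rw [h0, OperatorSpace.isOperatorSpaceNorm.smul_eq]
    exact mul_le_mul_of_nonneg_left (ha ⟨n, v, w, hv, hw, rfl⟩) (norm_nonneg c)

instance : MatrixNorm (MB V W X) where
  mnorm n φ := mbMatrixNorm n (φ.map fun ψ => (ψ : V →ₗ[ℂ] W →ₗ[ℂ] X))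

/-- The space of bilinear maps `φ : V × W → X` whose transpose is multiplicatively bounded,
with the matrix norm that it inherits from `MB(W × V, X)`. -/
def tMB : Submodule ℂ (V →ₗ[ℂ] W →ₗ[ℂ] X) :=
  (MB W V X).comap (LinearMap.lflip :
    (V →ₗ[ℂ] W →ₗ[ℂ] X) ≃ₗ[ℂ] (W →ₗ[ℂ] V →ₗ[ℂ] X)).toLinearMap

instance : MatrixNorm (tMB V W X) where
  mnorm n φ := mbMatrixNorm n (φ.map fun ψ => (ψ : V →ₗ[ℂ] W →ₗ[ℂ] X).flip)

end Spaces

/-! ### The `ℓ₁`-direct sum and the symmetrized multiplicatively bounded maps -/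

/-- The matrix norm of the operator space `E ⊕₁ F`: for `x ∈ M_n(E)` and `y ∈ M_n(F)`, the
supremum of `‖f_n(x) + g_n(y)‖` over all pairs of complete contractions `f : E → Z` and
`g : F → Z` into a common operator space `Z`. -/
def l1SumNorm {E F : Type u} [AddCommGroup E] [Module ℂ E] [MatrixNorm E]
    [AddCommGroup F] [Module ℂ F] [MatrixNorm F]
    (n : ℕ) (x : Matrix (Fin n) (Fin n) E) (y : Matrix (Fin n) (Fin n) F) : ℝ :=
  sSup {t | ∃ (Z : Type u) (_ : OperatorSpace Z) (f : E →ₗ[ℂ] Z) (g : F →ₗ[ℂ] Z),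
    IsCompleteContraction f ∧ IsCompleteContraction g ∧ t = mnorm n (x.map f + y.map g)}

section SMB

variable (V W X : Type u) [OperatorSpace V] [OperatorSpace W] [OperatorSpace X]

/-- The space `SMB(V × W, X)` of all sums `φ₁ + φ₂` where `φ₁` and the transpose of `φ₂` are
multiplicatively bounded. -/
def SMB : Submodule ℂ (V →ₗ[ℂ] W →ₗ[ℂ] X) := MB V W X ⊔ tMB V W X

/-- The norm of `M_n(SMB(V × W, X))`: the quotient norm of `MB ⊕₁ ᵗMB` under
`(φ₁, φ₂) ↦ φ₁ + φ₂`. -/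
def smbMatrixNorm (n : ℕ) (φ : Matrix (Fin n) (Fin n) (SMB V W X)) : ℝ :=
  sInf {t | ∃ (φ₁ : Matrix (Fin n) (Fin n) (MB V W X))
      (φ₂ : Matrix (Fin n) (Fin n) (tMB V W X)),
    (∀ i j, (φ i j : V →ₗ[ℂ] W →ₗ[ℂ] X) = φ₁ i j + φ₂ i j) ∧ t = l1SumNorm n φ₁ φ₂}

end SMB

/-! ### Operator space bilinear ideals -/

/-- The finite type continuous bilinear maps: finite sums of maps
`(v, w) ↦ f(v) g(w) x` with `f ∈ V*`, `g ∈ W*` and `x ∈ X`. -/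
def finiteType (V W X : Type u) [OperatorSpace V] [OperatorSpace W] [OperatorSpace X] :
    Submodule ℂ (V →ₗ[ℂ] W →ₗ[ℂ] X) :=
  Submodule.span ℂ {φ | ∃ (f : V →L[ℂ] ℂ) (g : W →L[ℂ] ℂ) (x : X),
    ∀ v w, φ v w = (f v * g w) • x}

/-- An assignment, to any three complete operator spaces `V`, `W`, `X`, of a linear subspace of
the bilinear maps `V × W → X` and of functions on the matrices over this subspace. -/
structure BilinearAssignment where
  space : ∀ (V W X : Type u) [OperatorSpace V] [CompleteSpace V] [OperatorSpace W]
    [CompleteSpace W] [OperatorSpace X] [CompleteSpace X], Submodule ℂ (V →ₗ[ℂ] W →ₗ[ℂ] X)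
  matrixNorm : ∀ (V W X : Type u) [OperatorSpace V] [CompleteSpace V] [OperatorSpace W]
    [CompleteSpace W] [OperatorSpace X] [CompleteSpace X] (n : ℕ),
    Matrix (Fin n) (Fin n) (space V W X) → ℝ

/-- The assignment `A` is an operator space bilinear ideal. -/
structure BilinearAssignment.IsOperatorSpaceIdeal (A : BilinearAssignment.{u}) : Prop where
  le_jcb : ∀ (V W X : Type u) [OperatorSpace V] [CompleteSpace V] [OperatorSpace W]
    [CompleteSpace W] [OperatorSpace X] [CompleteSpace X],
    ∀ φ ∈ A.space V W X, IsJCB φ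
  finiteType_le : ∀ (V W X : Type u) [OperatorSpace V] [CompleteSpace V] [OperatorSpace W]
    [CompleteSpace W] [OperatorSpace X] [CompleteSpace X],
    finiteType V W X ≤ A.space V W X
  isOperatorSpaceNorm : ∀ (V W X : Type u) [OperatorSpace V] [CompleteSpace V]
    [OperatorSpace W] [CompleteSpace W] [OperatorSpace X] [CompleteSpace X],
    IsOperatorSpaceNorm (A.matrixNorm V W X)
  jcb_le : ∀ (V W X : Type u) [OperatorSpace V] [CompleteSpace V] [OperatorSpace W]
    [CompleteSpace W] [OperatorSpace X] [CompleteSpace X] (n : ℕ)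
    (φ : Matrix (Fin n) (Fin n) (A.space V W X)),
    jcbMatrixNorm n (φ.map fun ψ => (ψ : V →ₗ[ℂ] W →ₗ[ℂ] X)) ≤ A.matrixNorm V W X n φ
  comp_le : ∀ (V W X U₁ U₂ Y : Type u) [OperatorSpace V] [CompleteSpace V] [OperatorSpace W]
    [CompleteSpace W] [OperatorSpace X] [CompleteSpace X] [OperatorSpace U₁]
    [CompleteSpace U₁] [OperatorSpace U₂] [CompleteSpace U₂] [OperatorSpace Y]
    [CompleteSpace Y] (n : ℕ) (φ : Matrix (Fin n) (Fin n) (A.space V W X))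
    (r₁ : U₁ →ₗ[ℂ] V) (r₂ : U₂ →ₗ[ℂ] W) (s : X →ₗ[ℂ] Y), IsCB r₁ → IsCB r₂ → IsCB s →
    ∃ h : ∀ i j, ((φ i j : V →ₗ[ℂ] W →ₗ[ℂ] X).compl₁₂ r₁ r₂).compr₂ s ∈ A.space U₁ U₂ Y,
      A.matrixNorm U₁ U₂ Y n
          (Matrix.of fun i j =>
            ⟨((φ i j : V →ₗ[ℂ] W →ₗ[ℂ] X).compl₁₂ r₁ r₂).compr₂ s, h i j⟩)
        ≤ cbNorm s * A.matrixNorm V W X n φ * cbNorm r₁ * cbNorm r₂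

/-- The assignment `A` is symmetric: if `φ` is in `A(V × W, X)`, then its transpose is in
`A(W × V, X)` and has the same norm. -/
def BilinearAssignment.IsSymmetric (A : BilinearAssignment.{u}) : Prop :=
  ∀ (V W X : Type u) [OperatorSpace V] [CompleteSpace V] [OperatorSpace W]
    [CompleteSpace W] [OperatorSpace X] [CompleteSpace X] (φ : A.space V W X),
    ∃ h : (φ : V →ₗ[ℂ] W →ₗ[ℂ] X).flip ∈ A.space W V X,
      A.matrixNorm V W X 1 (Matrix.of fun _ _ => φ)
        = A.matrixNorm W V X 1 (Matrix.of fun _ _ => ⟨(φ : V →ₗ[ℂ] W →ₗ[ℂ] X).flip, h⟩)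

/-- The assignment `SMB`, with the operator space structure of the sum `MB + ᵗMB`. -/
def smbAssignment : BilinearAssignment.{u} where
  space V W X := SMB V W X
  matrixNorm V W X := smbMatrixNorm V W X

end OpSp

end

noncomputable section

namespace OpSp

open MatrixNorm

/-! ### Norms of scalar matrices -/

/-! The notion that carries the proof is `IsMatSeminorm`: the operator space axioms without
definiteness, and with only `≤` for direct sums. Homogeneity and equality for direct sums follow
from (M2), so definiteness is the only axiom that needs a separate argument. Matrix seminorms are
stable under pullback along a linear map (`IsMatSeminorm.comp`), suprema (`of_isSup`) and quotients
(`of_isInf`).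

This produces the matrix norms one after another. The norm of `MB` is a supremum of pullbacks of the
norms of `M_m(X)` along `φ ↦ φ_(m)(v, w)`, with `v`, `w` in unit balls; that of `ᵗMB` is a pullback
of it; the `ℓ₁`-norm is a supremum of pullbacks along `(x, y) ↦ f x + g y`; and the norm of `SMB` is
a quotient of the latter.

The comparison with the jcb norm rests on the identities `φ_m(v, w) = φ_(m²)(v ⊗ 1, 1 ⊗ w) =
φᵗ_(m²)(1 ⊗ w, v ⊗ 1)` (`jointAmp_eq_multAmp`, `jointAmp_eq_multAmp_flip`). They make `φ ↦ φ_m(v,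
w)` a complete contraction on both `MB` and `ᵗMB`, with values in `Z = M_{m²}(X)`; this pair
therefore competes in the supremum that defines the `ℓ₁`-norm (`mnorm_jointAmp_le_smbMatrixNorm`).
Definiteness of the smb norm follows from the case `m = 1`.

Finite type maps already lie in `MB`, since `φ_(n)(v, w) = f(v) (x ⊗ 1) g(w)`. Composition and
transposition act separately on the two summands, so both reduce to functoriality of the `ℓ₁`-sum
(`l1SumNorm_map_le`). -/

lemma scalarNorm_nonneg {m n : ℕ} (α : Matrix (Fin m) (Fin n) ℂ) : 0 ≤ scalarNorm α :=
  norm_nonneg _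

lemma scalarNorm_le {m n : ℕ} (α : Matrix (Fin m) (Fin n) ℂ) {C : ℝ} (hC : 0 ≤ C)
    (h : ∀ x : Fin n → ℂ, ∑ i, ‖α.mulVec x i‖ ^ 2 ≤ C ^ 2 * ∑ j, ‖x j‖ ^ 2) :
    scalarNorm α ≤ C := by
  refine ContinuousLinearMap.opNorm_le_bound _ hC fun x => ?_
  refine le_of_sq_le_sq ?_ (by positivity)
  rw [mul_pow, EuclideanSpace.norm_sq_eq, EuclideanSpace.norm_sq_eq]
  exact h x.ofLp

lemma sum_norm_mulVec_sq_le {m n : ℕ} (α : Matrix (Fin m) (Fin n) ℂ) (x : Fin n → ℂ) :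
    ∑ i, ‖α.mulVec x i‖ ^ 2 ≤ scalarNorm α ^ 2 * ∑ j, ‖x j‖ ^ 2 := by
  have h := (Matrix.toEuclideanLin α).toContinuousLinearMap.le_opNorm (WithLp.toLp 2 x)
  have h2 := pow_le_pow_left₀ (norm_nonneg _) h 2
  rw [mul_pow, EuclideanSpace.norm_sq_eq, EuclideanSpace.norm_sq_eq] at h2
  exact h2

open scoped Matrix.Norms.L2Operator in
lemma scalarNorm_conjTranspose {m n : ℕ} (α : Matrix (Fin m) (Fin n) ℂ) :
    scalarNorm α.conjTranspose = scalarNorm α :=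
  Matrix.l2_opNorm_conjTranspose α

lemma scalarNorm_smul {m n : ℕ} (c : ℂ) (α : Matrix (Fin m) (Fin n) ℂ) :
    scalarNorm (c • α) = ‖c‖ * scalarNorm α := by
  simp only [scalarNorm, map_smul, norm_smul]

/-- The `0`-`1` matrix whose `i`-th row has its entry `1` in column `f i`. -/
def selection {m n : ℕ} (f : Fin m → Fin n) : Matrix (Fin m) (Fin n) ℂ :=
  Matrix.of fun i k => if f i = k then 1 else 0

/-- The matrix sends `x` to the coordinates `x (f i)`; injectivity prevents any coordinate from
being counted twice. -/
lemma scalarNorm_selection_le {m n : ℕ} {f : Fin m → Fin n} (hf : Function.Injective f) :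
    scalarNorm (selection f) ≤ 1 := by
  refine scalarNorm_le _ zero_le_one fun x => ?_
  have h : ∀ i, (selection f).mulVec x i = x (f i) := fun i => by
    simp [selection, Matrix.mulVec, dotProduct]
  simp only [h, one_pow, one_mul]
  rw [← Finset.sum_image (f := fun j => ‖x j‖ ^ 2) (s := Finset.univ) (g := f)
    (fun a _ b _ hab => hf hab)]
  exact Finset.sum_le_sum_of_subset_of_nonneg (Finset.subset_univ _) fun _ _ _ => by positivity

lemma scalarNorm_selection_transpose_le {m n : ℕ} {f : Fin m → Fin n}
    (hf : Function.Injective f) : scalarNorm (selection f).transpose ≤ 1 := by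
  have h : (selection f).transpose = (selection f).conjTranspose := by
    ext i j
    simp [selection, Matrix.conjTranspose_apply, apply_ite]
  rw [h, scalarNorm_conjTranspose]
  exact scalarNorm_selection_le hf

lemma scalarNorm_one_le (n : ℕ) : scalarNorm (1 : Matrix (Fin n) (Fin n) ℂ) ≤ 1 := by
  have h : (1 : Matrix (Fin n) (Fin n) ℂ) = selection id := by
    ext i j
    simp [selection, Matrix.one_apply]
  rw [h]
  exact scalarNorm_selection_le Function.injective_id

/-- The scalar matrix `α ⊗ 1_k`. -/
def tensorOne {m n : ℕ} (α : Matrix (Fin m) (Fin n) ℂ) (k : ℕ) :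
    Matrix (Fin (m * k)) (Fin (n * k)) ℂ :=
  Matrix.reindex finProdFinEquiv finProdFinEquiv
    (Matrix.of fun p q : _ × Fin k => if p.2 = q.2 then α p.1 q.1 else 0)

/-- On `ℓ₂ⁿ ⊗ ℓ₂ᵏ` the matrix acts as `α` on each of the `k` slices of `x`, and the squared norms of
the slices add up. -/
lemma scalarNorm_tensorOne_le {m n : ℕ} (α : Matrix (Fin m) (Fin n) ℂ) (k : ℕ) :
    scalarNorm (tensorOne α k) ≤ scalarNorm α := by
  refine scalarNorm_le _ (scalarNorm_nonneg α) fun x => ?_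
  have h : ∀ p : Fin m × Fin k, (tensorOne α k).mulVec x (finProdFinEquiv p)
      = α.mulVec (fun j => x (finProdFinEquiv (j, p.2))) p.1 := fun p => by
    simp only [Matrix.mulVec, dotProduct]
    rw [← finProdFinEquiv.sum_comp, Fintype.sum_prod_type]
    simp [tensorOne]
  rw [← finProdFinEquiv.sum_comp, ← finProdFinEquiv.sum_comp, Fintype.sum_prod_type_right,
    Fintype.sum_prod_type_right, Finset.mul_sum]
  refine Finset.sum_le_sum fun b _ => ?_
  simp only [h]
  exact sum_norm_mulVec_sq_le α fun j => x (finProdFinEquiv (j, b))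

/-! ### Matrix seminorms -/

section Seminorm

variable {E F : Type*} [AddCommGroup E] [Module ℂ E] [AddCommGroup F] [Module ℂ F]

/-- The operator space axioms without definiteness. -/
structure IsMatSeminorm (N : ∀ n : ℕ, Matrix (Fin n) (Fin n) E → ℝ) : Prop where
  nonneg : ∀ (n : ℕ) (v : Matrix (Fin n) (Fin n) E), 0 ≤ N n v
  add_le : ∀ (n : ℕ) (v w : Matrix (Fin n) (Fin n) E), N n (v + w) ≤ N n v + N n w
  direct_sum_le : ∀ (n m : ℕ) (v : Matrix (Fin n) (Fin n) E) (w : Matrix (Fin m) (Fin m) E),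
    N (n + m) (directSum v w) ≤ max (N n v) (N m w)
  sandwich_le : ∀ (n m : ℕ) (α : Matrix (Fin m) (Fin n) ℂ) (v : Matrix (Fin n) (Fin n) E)
    (β : Matrix (Fin n) (Fin m) ℂ),
    N m (sandwich α v β) ≤ scalarNorm α * N n v * scalarNorm β

lemma IsOperatorSpaceNorm.isMatSeminorm {N : ∀ n : ℕ, Matrix (Fin n) (Fin n) E → ℝ}
    (h : IsOperatorSpaceNorm N) : IsMatSeminorm N :=
  ⟨h.nonneg, h.add_le, fun n m v w => (h.direct_sum n m v w).le, h.sandwich_le⟩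

lemma sandwich_map {n m : ℕ} (T : E →ₗ[ℂ] F) (α : Matrix (Fin m) (Fin n) ℂ)
    (v : Matrix (Fin n) (Fin n) E) (β : Matrix (Fin n) (Fin m) ℂ) :
    (sandwich α v β).map T = sandwich α (v.map T) β := by
  ext i j
  simp [sandwich]

lemma directSum_map {n m : ℕ} (T : E →ₗ[ℂ] F) (v : Matrix (Fin n) (Fin n) E)
    (w : Matrix (Fin m) (Fin m) E) :
    (directSum v w).map T = directSum (v.map T) (w.map T) := by
  have h : Matrix.fromBlocks (v.map T) 0 0 (w.map T) = (Matrix.fromBlocks v 0 0 w).map T := by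
    rw [Matrix.fromBlocks_map]
    simp
  simp only [directSum, h]
  rfl

lemma sandwich_selection {m n : ℕ} (f g : Fin m → Fin n) (v : Matrix (Fin n) (Fin n) E) :
    sandwich (selection f) v (selection g).transpose = v.submatrix f g := by
  ext i j
  simp [sandwich, selection]

namespace IsMatSeminorm

variable {N : ∀ n : ℕ, Matrix (Fin n) (Fin n) E → ℝ} (h : IsMatSeminorm N)
include h

lemma sandwich_le_of_le_one {n m : ℕ} {α : Matrix (Fin m) (Fin n) ℂ}
    (v : Matrix (Fin n) (Fin n) E) {β : Matrix (Fin n) (Fin m) ℂ} (hα : scalarNorm α ≤ 1)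
    (hβ : scalarNorm β ≤ 1) : N m (sandwich α v β) ≤ N n v := by
  have h0 := h.nonneg n v
  have h1 := scalarNorm_nonneg β
  calc N m (sandwich α v β) ≤ scalarNorm α * N n v * scalarNorm β := h.sandwich_le ..
    _ ≤ 1 * N n v * 1 := by gcongr
    _ = N n v := by ring

/-- Compressions and permutations are products with selection matrices. Every later identification
of index sets is isometric for this reason. -/
lemma submatrix_le {m n : ℕ} {f g : Fin m → Fin n} (hf : Function.Injective f)
    (hg : Function.Injective g) (v : Matrix (Fin n) (Fin n) E) :
    N m (v.submatrix f g) ≤ N n v := by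
  rw [← sandwich_selection]
  exact h.sandwich_le_of_le_one v (scalarNorm_selection_le hf)
    (scalarNorm_selection_transpose_le hg)

lemma reindex_le {m n : ℕ} (e : Fin n ≃ Fin m) (v : Matrix (Fin n) (Fin n) E) :
    N m (Matrix.reindex e e v) ≤ N n v :=
  h.submatrix_le e.symm.injective e.symm.injective v

lemma smul_le (n : ℕ) (c : ℂ) (v : Matrix (Fin n) (Fin n) E) : N n (c • v) ≤ ‖c‖ * N n v := by
  have h1 : c • v = sandwich (c • (1 : Matrix (Fin n) (Fin n) ℂ)) v 1 := by
    ext i j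
    simp [sandwich, Matrix.one_apply]
  have h0 := h.nonneg n v
  have h2 := scalarNorm_nonneg (1 : Matrix (Fin n) (Fin n) ℂ)
  have h3 := scalarNorm_one_le n
  rw [h1]
  calc _ ≤ _ := h.sandwich_le ..
    _ = ‖c‖ * scalarNorm (1 : Matrix (Fin n) (Fin n) ℂ) * N n v
        * scalarNorm (1 : Matrix (Fin n) (Fin n) ℂ) := by rw [scalarNorm_smul]
    _ ≤ ‖c‖ * 1 * N n v * 1 := by gcongr
    _ = _ := by ring

lemma zero_eq (n : ℕ) : N n 0 = 0 := by
  have h1 := h.smul_le n 0 0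
  simp only [zero_smul, norm_zero, zero_mul] at h1
  exact le_antisymm h1 (h.nonneg n 0)

lemma smul_eq (n : ℕ) (c : ℂ) (v : Matrix (Fin n) (Fin n) E) : N n (c • v) = ‖c‖ * N n v := by
  refine le_antisymm (h.smul_le n c v) ?_
  rcases eq_or_ne c 0 with rfl | hc
  · simpa using h.nonneg n _
  · have h1 := h.smul_le n c⁻¹ (c • v)
    rw [inv_smul_smul₀ hc, norm_inv] at h1
    have h2 : 0 < ‖c‖ := norm_pos_iff.mpr hc
    calc ‖c‖ * N n v ≤ ‖c‖ * (‖c‖⁻¹ * N n (c • v)) := by gcongr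
      _ = N n (c • v) := by field_simp

lemma sum_le {ι : Type*} (s : Finset ι) {n : ℕ} (v : ι → Matrix (Fin n) (Fin n) E) :
    N n (∑ i ∈ s, v i) ≤ ∑ i ∈ s, N n (v i) :=
  Finset.le_sum_of_subadditive (N n) (h.zero_eq n).le (h.add_le n) s v

/-- Both summands are corner compressions of the direct sum, which gives the inequality missing from
`IsMatSeminorm`. -/
lemma direct_sum_eq (n m : ℕ) (v : Matrix (Fin n) (Fin n) E) (w : Matrix (Fin m) (Fin m) E) :
    N (n + m) (directSum v w) = max (N n v) (N m w) := by
  refine le_antisymm (h.direct_sum_le n m v w) (max_le ?_ ?_)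
  · have h1 : v = (directSum v w).submatrix (Fin.castAdd m) (Fin.castAdd m) := by
      ext i j
      simp [directSum]
    conv_lhs => rw [h1]
    exact h.submatrix_le (Fin.castAdd_injective n m) (Fin.castAdd_injective n m) _
  · have h1 : w = (directSum v w).submatrix (Fin.natAdd n) (Fin.natAdd n) := by
      ext i j
      simp [directSum]
    conv_lhs => rw [h1]
    exact h.submatrix_le (Fin.natAdd_injective m n) (Fin.natAdd_injective m n) _

lemma isOperatorSpaceNorm (h0 : ∀ (n : ℕ) (v : Matrix (Fin n) (Fin n) E), N n v = 0 → v = 0) :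
    IsOperatorSpaceNorm N :=
  ⟨h.nonneg, h0, h.smul_eq, h.add_le, h.direct_sum_eq, h.sandwich_le⟩

lemma le_sum_entries {n : ℕ} (v : Matrix (Fin n) (Fin n) E) :
    N n v ≤ ∑ i, ∑ j, N 1 (Matrix.of fun _ _ => v i j) := by
  have h1 : v = ∑ i, ∑ j, sandwich (selection fun _ : Fin 1 => i).transpose
      (Matrix.of fun _ _ : Fin 1 => v i j) (selection fun _ : Fin 1 => j) := by
    ext a b
    simp [Matrix.sum_apply, sandwich, selection]
  conv_lhs => rw [h1]
  refine (h.sum_le _ _).trans (Finset.sum_le_sum fun i _ => (h.sum_le _ _).trans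
    (Finset.sum_le_sum fun j _ => h.sandwich_le_of_le_one _
      (scalarNorm_selection_transpose_le ?_) (scalarNorm_selection_le ?_))) <;>
  exact Function.injective_of_subsingleton _

omit h in
lemma comp {M : ∀ n : ℕ, Matrix (Fin n) (Fin n) F → ℝ} (hM : IsMatSeminorm M)
    (T : E →ₗ[ℂ] F) : IsMatSeminorm fun n (v : Matrix (Fin n) (Fin n) E) => M n (v.map T) where
  nonneg n v := hM.nonneg n _
  add_le n v w := by
    rw [Matrix.map_add _ (map_add T)]
    exact hM.add_le n _ _
  direct_sum_le n m v w := by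
    rw [directSum_map]
    exact hM.direct_sum_le n m _ _
  sandwich_le n m α v β := by
    rw [sandwich_map]
    exact hM.sandwich_le n m _ _ _

omit h in
-- Each axiom bounds `N` above by an expression monotone in values of `N`, so it passes to suprema.
-- Leastness is required only among `C ≥ 0`, which suits the convention `sSup ∅ = 0`.
lemma of_isSup {ι : Type*} {M : ι → ∀ n : ℕ, Matrix (Fin n) (Fin n) E → ℝ}
    (hM : ∀ i, IsMatSeminorm (M i)) (nonneg : ∀ n v, 0 ≤ N n v)
    (le : ∀ i n v, M i n v ≤ N n v)
    (least : ∀ n v (C : ℝ), 0 ≤ C → (∀ i, M i n v ≤ C) → N n v ≤ C) : IsMatSeminorm N where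
  nonneg := nonneg
  add_le n v w := least _ _ _ (add_nonneg (nonneg _ _) (nonneg _ _)) fun i =>
    ((hM i).add_le n v w).trans (add_le_add (le i n v) (le i n w))
  direct_sum_le n m v w := least _ _ _ (le_max_of_le_left (nonneg _ _)) fun i =>
    ((hM i).direct_sum_le n m v w).trans (max_le_max (le i n v) (le i m w))
  sandwich_le n m α v β := by
    have h1 := scalarNorm_nonneg α
    have h2 := scalarNorm_nonneg β
    have h3 := nonneg n v
    refine least _ _ _ (by positivity) fun i => ((hM i).sandwich_le n m α v β).trans ?_
    have := le i n v
    gcongr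

/-- The quotient construction: each axiom is checked on lifts that are optimal up to `ε`. -/
lemma of_isInf {M : ∀ n : ℕ, Matrix (Fin n) (Fin n) F → ℝ} (T : E →ₗ[ℂ] F)
    (nonneg : ∀ n v, 0 ≤ M n v) (le : ∀ n x, M n (x.map T) ≤ N n x)
    (greatest : ∀ n v (ε : ℝ), 0 < ε → ∃ x : Matrix (Fin n) (Fin n) E,
      x.map T = v ∧ N n x ≤ M n v + ε) : IsMatSeminorm M where
  nonneg := nonneg
  add_le n v w := by
    refine le_of_forall_pos_le_add fun ε hε => ?_
    obtain ⟨x, rfl, hx⟩ := greatest n v (ε / 2) (half_pos hε)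
    obtain ⟨y, rfl, hy⟩ := greatest n w (ε / 2) (half_pos hε)
    rw [← Matrix.map_add _ (map_add T)]
    linarith [le n (x + y), h.add_le n x y]
  direct_sum_le n m v w := by
    refine le_of_forall_pos_le_add fun ε hε => ?_
    obtain ⟨x, rfl, hx⟩ := greatest n v ε hε
    obtain ⟨y, rfl, hy⟩ := greatest m w ε hε
    rw [← directSum_map, ← max_add_add_right]
    exact ((le _ _).trans (h.direct_sum_le n m x y)).trans (max_le_max hx hy)
  sandwich_le n m α v β := by
    have h1 := scalarNorm_nonneg α
    have h2 := scalarNorm_nonneg β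
    refine le_of_forall_pos_le_add fun ε hε => ?_
    -- The summand `1` keeps `K` positive when a scalar matrix vanishes.
    set K := scalarNorm α * scalarNorm β + 1 with hK
    have hK0 : 0 < K := by positivity
    obtain ⟨x, rfl, hx⟩ := greatest n v (ε / K) (by positivity)
    rw [← sandwich_map]
    calc _ ≤ _ := le _ _
      _ ≤ scalarNorm α * N n x * scalarNorm β := h.sandwich_le n m α x β
      _ ≤ scalarNorm α * (M n (x.map T) + ε / K) * scalarNorm β := by gcongr
      _ = scalarNorm α * M n (x.map T) * scalarNorm β
          + (scalarNorm α * scalarNorm β) * (ε / K) := by ring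
      _ ≤ scalarNorm α * M n (x.map T) * scalarNorm β + K * (ε / K) := by
          gcongr
          linarith
      _ = _ := by field_simp

end IsMatSeminorm

end Seminorm

/-! ### Matrix spaces over operator spaces -/

section Nested

variable {X : Type*} [AddCommGroup X] [Module ℂ X] [MatrixNorm X]

omit [AddCommGroup X] [Module ℂ X] in
lemma mnorm_matrix_def {n m : ℕ} (y : Matrix (Fin m) (Fin m) (Matrix (Fin n) (Fin n) X)) :
    mnorm m y = mnorm (m * n) (Matrix.reindex finProdFinEquiv finProdFinEquiv
      (Matrix.of fun p q : Fin m × Fin n => y p.1 q.1 p.2 q.2)) := rfl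

lemma IsMatSeminorm.matrix (hX : IsMatSeminorm (mnorm (E := X))) (k : ℕ) :
    IsMatSeminorm (mnorm (E := Matrix (Fin k) (Fin k) X)) where
  nonneg n v := hX.nonneg _ _
  add_le n v w := hX.add_le _ _ _
  direct_sum_le n m v w := by
    -- Distributivity `(n ⊔ m) × k ≃ n × k ⊔ m × k`, under which the nested direct sum becomes an
    -- ordinary one.
    let e : Fin (n * k + m * k) ≃ Fin ((n + m) * k) :=
      finSumFinEquiv.symm.trans (((finProdFinEquiv.symm.sumCongr finProdFinEquiv.symm).trans
        (Equiv.sumProdDistrib _ _ _).symm).trans ((finSumFinEquiv.prodCongr (Equiv.refl _)).trans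
          finProdFinEquiv))
    refine le_trans (le_of_eq ?_) ((hX.reindex_le e _).trans (hX.direct_sum_le _ _ _ _))
    rw [mnorm_matrix_def]
    congr 1
    ext a b
    obtain ⟨⟨a, a'⟩, rfl⟩ := finProdFinEquiv.surjective a
    obtain ⟨⟨b, b'⟩, rfl⟩ := finProdFinEquiv.surjective b
    obtain ⟨a, rfl⟩ := finSumFinEquiv.surjective a
    obtain ⟨b, rfl⟩ := finSumFinEquiv.surjective b
    rcases a with a | a <;> rcases b with b | b <;> simp [directSum, e]
  sandwich_le n m α v β := by
    -- Under `M_n(M_k(X)) = M_{nk}(X)` the product `α v β` becomes `(α ⊗ 1_k) v (β ⊗ 1_k)`.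
    have h1 := scalarNorm_tensorOne_le α k
    have h2 := scalarNorm_tensorOne_le β k
    have h3 := scalarNorm_nonneg (tensorOne α k)
    have h4 := scalarNorm_nonneg (tensorOne β k)
    have h5 : 0 ≤ mnorm n v := hX.nonneg _ _
    have h6 := scalarNorm_nonneg α
    refine le_trans (le_of_eq ?_) ((hX.sandwich_le _ _ (tensorOne α k) _ (tensorOne β k)).trans
      (b := scalarNorm (tensorOne α k) * mnorm n v * scalarNorm (tensorOne β k)) ?_)
    · rw [mnorm_matrix_def]
      congr 1
      ext a b
      obtain ⟨⟨a, a'⟩, rfl⟩ := finProdFinEquiv.surjective a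
      obtain ⟨⟨b, b'⟩, rfl⟩ := finProdFinEquiv.surjective b
      simp only [sandwich, Matrix.of_apply, Matrix.reindex_apply, Matrix.submatrix_apply,
        Equiv.symm_apply_apply, Matrix.sum_apply, Matrix.smul_apply]
      rw [← finProdFinEquiv.sum_comp, Fintype.sum_prod_type]
      simp_rw [← finProdFinEquiv.sum_comp, Fintype.sum_prod_type]
      simp [tensorOne]
    · rw [mnorm_matrix_def] at h5 ⊢
      gcongr

lemma IsOperatorSpaceNorm.matrix (hX : IsOperatorSpaceNorm (mnorm (E := X))) (k : ℕ) :
    IsOperatorSpaceNorm (mnorm (E := Matrix (Fin k) (Fin k) X)) :=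
  (hX.isMatSeminorm.matrix k).isOperatorSpaceNorm fun n v hv => by
    have h := hX.eq_zero _ _ hv
    ext i j a b
    simpa using congrFun (congrFun h (finProdFinEquiv (i, a))) (finProdFinEquiv (j, b))

lemma mnorm_transpose_le (hX : IsMatSeminorm (mnorm (E := X))) {n m : ℕ}
    (y : Matrix (Fin m) (Fin m) (Matrix (Fin n) (Fin n) X)) :
    mnorm n (Matrix.of fun i j => Matrix.of fun a b => y a b i j) ≤ mnorm m y := by
  let e : Fin (m * n) ≃ Fin (n * m) :=
    (finProdFinEquiv.symm.trans (Equiv.prodComm _ _)).trans finProdFinEquiv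
  refine le_trans (le_of_eq ?_) (hX.reindex_le e _)
  rw [mnorm_matrix_def]
  congr 1
  ext a b
  obtain ⟨⟨a, a'⟩, rfl⟩ := finProdFinEquiv.surjective a
  obtain ⟨⟨b, b'⟩, rfl⟩ := finProdFinEquiv.surjective b
  simp [e]

/-- Interchanging the two levels of matrices is isometric. -/
lemma mnorm_transpose (hX : IsMatSeminorm (mnorm (E := X))) {n m : ℕ}
    (y : Matrix (Fin m) (Fin m) (Matrix (Fin n) (Fin n) X)) :
    mnorm n (Matrix.of fun i j => Matrix.of fun a b => y a b i j) = mnorm m y :=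
  le_antisymm (mnorm_transpose_le hX y) (mnorm_transpose_le hX _)

lemma mnorm_one_matrix (hX : IsMatSeminorm (mnorm (E := X))) {n : ℕ}
    (y : Matrix (Fin n) (Fin n) X) : mnorm 1 (Matrix.of fun _ _ : Fin 1 => y) = mnorm n y := by
  let e : Fin n ≃ Fin (1 * n) := (Equiv.uniqueProd (Fin n) (Fin 1)).symm.trans finProdFinEquiv
  have h1 : Matrix.reindex finProdFinEquiv finProdFinEquiv
      (Matrix.of fun p q : Fin 1 × Fin n => y p.2 q.2) = Matrix.reindex e e y := by
    ext a b
    obtain ⟨⟨a, a'⟩, rfl⟩ := finProdFinEquiv.surjective a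
    obtain ⟨⟨b, b'⟩, rfl⟩ := finProdFinEquiv.surjective b
    simp [e]
  rw [mnorm_matrix_def]
  simp only [Matrix.of_apply]
  rw [h1]
  refine le_antisymm (hX.reindex_le e y) ?_
  have h2 := hX.reindex_le e.symm (Matrix.reindex e e y)
  simpa using h2

/-- `M_k(X)` as an operator space. -/
@[reducible] def matrixOperatorSpace (hX : IsOperatorSpaceNorm (mnorm (E := X))) (k : ℕ) :
    OperatorSpace (Matrix (Fin k) (Fin k) X) :=
  letI : Norm (Matrix (Fin k) (Fin k) X) := ⟨mnorm k⟩
  let core : NormedSpace.Core ℂ (Matrix (Fin k) (Fin k) X) :=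
    { norm_nonneg := hX.nonneg k
      norm_smul := hX.smul_eq k
      norm_triangle := hX.add_le k
      norm_eq_zero_iff := fun v => ⟨hX.eq_zero k v, fun h => by
        rw [h]; exact hX.isMatSeminorm.zero_eq k⟩ }
  letI g : NormedAddCommGroup (Matrix (Fin k) (Fin k) X) := NormedAddCommGroup.ofCore core
  { g, NormedSpace.ofCore core, matrixMatrixNorm X k with
    isOperatorSpaceNorm := hX.matrix k
    mnorm_one := mnorm_one_matrix hX.isMatSeminorm }

/-- The amplification `v ⊗ 1_k`. -/
def amplify {n : ℕ} (v : Matrix (Fin n) (Fin n) X) (k : ℕ) :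
    Matrix (Fin (n * k)) (Fin (n * k)) X :=
  Matrix.reindex finProdFinEquiv finProdFinEquiv
    (Matrix.of fun p q : Fin n × Fin k => if p.2 = q.2 then v p.1 q.1 else 0)

/-- The amplification `1_k ⊗ v`. -/
def amplifyLeft {n : ℕ} (k : ℕ) (v : Matrix (Fin n) (Fin n) X) :
    Matrix (Fin (k * n)) (Fin (k * n)) X :=
  Matrix.reindex finProdFinEquiv finProdFinEquiv
    (Matrix.of fun p q : Fin k × Fin n => if p.1 = q.1 then v p.2 q.2 else 0)

lemma mnorm_amplify_le (hX : IsMatSeminorm (mnorm (E := X))) {n : ℕ}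
    (v : Matrix (Fin n) (Fin n) X) (k : ℕ) : mnorm (n * k) (amplify v k) ≤ mnorm n v := by
  induction k with
  | zero =>
    have h : amplify v 0 = 0 := by
      ext a b
      exact (finProdFinEquiv.symm a).2.elim0
    rw [h, hX.zero_eq]
    exact hX.nonneg _ _
  | succ k ih =>
    -- Up to this permutation `v ⊗ 1_{k+1}` is `(v ⊗ 1_k) ⊕ v`.
    let e : Fin (n * k + n) ≃ Fin (n * (k + 1)) :=
      finSumFinEquiv.symm.trans (((finProdFinEquiv.symm.sumCongr
        (Equiv.prodUnique (Fin n) (Fin 1)).symm).trans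
        (Equiv.prodSumDistrib _ _ _).symm).trans (((Equiv.refl _).prodCongr finSumFinEquiv).trans
          finProdFinEquiv))
    refine le_trans (le_of_eq ?_) ((hX.reindex_le e (directSum (amplify v k) v)).trans
      ((hX.direct_sum_le _ _ _ _).trans (max_le ih le_rfl)))
    congr 1
    ext a b
    obtain ⟨⟨a, a'⟩, rfl⟩ := finProdFinEquiv.surjective a
    obtain ⟨⟨b, b'⟩, rfl⟩ := finProdFinEquiv.surjective b
    obtain ⟨a', rfl⟩ := finSumFinEquiv.surjective a'
    obtain ⟨b', rfl⟩ := finSumFinEquiv.surjective b'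
    rcases a' with a' | a' <;> rcases b' with b' | b' <;>
      simp [amplify, directSum, e, Fin.ext_iff] <;> omega

lemma mnorm_amplifyLeft_le (hX : IsMatSeminorm (mnorm (E := X))) {n : ℕ}
    (k : ℕ) (v : Matrix (Fin n) (Fin n) X) : mnorm (k * n) (amplifyLeft k v) ≤ mnorm n v := by
  let e : Fin (n * k) ≃ Fin (k * n) :=
    (finProdFinEquiv.symm.trans (Equiv.prodComm _ _)).trans finProdFinEquiv
  refine le_trans (le_of_eq ?_) ((hX.reindex_le e _).trans (mnorm_amplify_le hX v k))
  congr 1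
  ext a b
  obtain ⟨⟨a, a'⟩, rfl⟩ := finProdFinEquiv.surjective a
  obtain ⟨⟨b, b'⟩, rfl⟩ := finProdFinEquiv.surjective b
  simp [e, amplify, amplifyLeft]

end Nested

/-- Serves normalization by `‖v‖ + ε` in place of `‖v‖`, which may be zero. -/
lemma le_mul_of_forall_pos {a b c : ℝ} (hc : 0 ≤ c) (h : ∀ ε > 0, a ≤ (b + ε) * c) :
    a ≤ b * c := by
  refine le_of_forall_pos_le_add fun ε hε => (h (ε / (c + 1)) (by positivity)).trans ?_
  have h1 : ε / (c + 1) * c ≤ ε / (c + 1) * (c + 1) := by gcongr; linarith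
  have h2 : ε / (c + 1) * (c + 1) = ε := by field_simp
  linarith

/-! ### Completely bounded maps -/

section Linear

variable {E F : Type*} [AddCommGroup E] [Module ℂ E] [MatrixNorm E]
  [AddCommGroup F] [Module ℂ F] [MatrixNorm F]

lemma cbNorm_nonneg (hF : IsMatSeminorm (mnorm (E := F))) (r : E →ₗ[ℂ] F) : 0 ≤ cbNorm r :=
  Real.sSup_nonneg fun t ht => by
    obtain ⟨n, v, -, rfl⟩ := ht
    exact hF.nonneg _ _

/-- A matrix scaled into the unit ball. -/
lemma IsMatSeminorm.mnorm_smul_inv_le (hE : IsMatSeminorm (mnorm (E := E))) {n : ℕ}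
    (v : Matrix (Fin n) (Fin n) E) {ε : ℝ} (hε : 0 < ε) :
    mnorm n (((mnorm n v + ε : ℝ) : ℂ)⁻¹ • v) ≤ 1 := by
  have h0 := hE.nonneg n v
  rw [hE.smul_eq, norm_inv, Complex.norm_real, Real.norm_of_nonneg (by positivity),
    inv_mul_le_one₀ (by positivity)]
  linarith

lemma IsCB.mnorm_map_le (hE : IsMatSeminorm (mnorm (E := E)))
    (hF : IsMatSeminorm (mnorm (E := F))) {r : E →ₗ[ℂ] F} (hr : IsCB r) {n : ℕ}
    (v : Matrix (Fin n) (Fin n) E) : mnorm n (v.map r) ≤ cbNorm r * mnorm n v := by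
  rw [mul_comm]
  refine le_mul_of_forall_pos (cbNorm_nonneg hF r) fun ε hε => ?_
  have h0 := hE.nonneg n v
  have h1 : mnorm n ((((mnorm n v + ε : ℝ) : ℂ)⁻¹ • v).map r) ≤ cbNorm r :=
    le_csSup hr ⟨n, _, hE.mnorm_smul_inv_le v hε, rfl⟩
  rw [Matrix.map_smul _ _ (map_smul r _), hF.smul_eq, norm_inv, Complex.norm_real,
    Real.norm_of_nonneg (by positivity), inv_mul_le_iff₀ (by positivity)] at h1
  exact h1

lemma IsCompleteContraction.mnorm_map_le (hE : IsMatSeminorm (mnorm (E := E)))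
    (hF : IsMatSeminorm (mnorm (E := F))) {r : E →ₗ[ℂ] F} (hr : IsCompleteContraction r) {n : ℕ}
    (v : Matrix (Fin n) (Fin n) E) : mnorm n (v.map r) ≤ mnorm n v :=
  (hr.1.mnorm_map_le hE hF v).trans (mul_le_of_le_one_left (hE.nonneg n v) hr.2)

lemma isCompleteContraction_of_le {r : E →ₗ[ℂ] F}
    (h : ∀ n (v : Matrix (Fin n) (Fin n) E), mnorm n v ≤ 1 → mnorm n (v.map r) ≤ 1) :
    IsCompleteContraction r := by
  have h1 : ∀ t ∈ cbValues r, t ≤ 1 := by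
    rintro t ⟨n, v, hv, rfl⟩
    exact h n v hv
  exact ⟨⟨1, h1⟩, Real.sSup_le h1 zero_le_one⟩

end Linear

section Bilinear

variable {V W X : Type*} [AddCommGroup V] [Module ℂ V] [AddCommGroup W] [Module ℂ W]
  [AddCommGroup X] [Module ℂ X] [MatrixNorm V] [MatrixNorm W] [MatrixNorm X]

/-! ### Multiplicatively bounded maps -/

omit [MatrixNorm V] [MatrixNorm W] [MatrixNorm X] in
lemma assemble_apply {n : ℕ} (φ : Matrix (Fin n) (Fin n) (V →ₗ[ℂ] W →ₗ[ℂ] X)) (v : V) (w : W)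
    (i j : Fin n) : assemble φ v w i j = φ i j v w := rfl

lemma mbNorm_nonneg (hX : IsMatSeminorm (mnorm (E := X))) (φ : V →ₗ[ℂ] W →ₗ[ℂ] X) :
    0 ≤ mbNorm φ :=
  Real.sSup_nonneg fun t ht => by
    obtain ⟨n, v, w, -, -, rfl⟩ := ht
    exact hX.nonneg _ _

lemma IsMB.mnorm_multAmp_le_of_le_one {φ : V →ₗ[ℂ] W →ₗ[ℂ] X} (hφ : IsMB φ) {n : ℕ}
    {v : Matrix (Fin n) (Fin n) V} {w : Matrix (Fin n) (Fin n) W} (hv : mnorm n v ≤ 1)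
    (hw : mnorm n w ≤ 1) : mnorm n (multAmp φ n v w) ≤ mbNorm φ :=
  le_csSup hφ ⟨n, v, w, hv, hw, rfl⟩

omit [MatrixNorm V] [MatrixNorm W] [MatrixNorm X] in
lemma multAmp_smul_smul (φ : V →ₗ[ℂ] W →ₗ[ℂ] X) (n : ℕ) (a b : ℂ)
    (v : Matrix (Fin n) (Fin n) V) (w : Matrix (Fin n) (Fin n) W) :
    multAmp φ n (a • v) (b • w) = a • b • multAmp φ n v w := by
  ext i j
  simp [multAmp, Finset.smul_sum, smul_comm a b]

lemma IsMB.mnorm_multAmp_le (hV : IsMatSeminorm (mnorm (E := V)))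
    (hW : IsMatSeminorm (mnorm (E := W))) (hX : IsMatSeminorm (mnorm (E := X)))
    {φ : V →ₗ[ℂ] W →ₗ[ℂ] X} (hφ : IsMB φ) {n : ℕ}
    (v : Matrix (Fin n) (Fin n) V) (w : Matrix (Fin n) (Fin n) W) :
    mnorm n (multAmp φ n v w) ≤ mbNorm φ * mnorm n v * mnorm n w := by
  have hv := hV.nonneg n v
  have hw := hW.nonneg n w
  have hn := mbNorm_nonneg hX φ
  have key : ∀ ε > 0, ∀ δ > 0,
      mnorm n (multAmp φ n v w) ≤ (mnorm n w + δ) * ((mnorm n v + ε) * mbNorm φ) := by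
    intro ε hε δ hδ
    have h1 := hφ.mnorm_multAmp_le_of_le_one (hV.mnorm_smul_inv_le v hε)
      (hW.mnorm_smul_inv_le w hδ)
    rw [multAmp_smul_smul, hX.smul_eq, hX.smul_eq, norm_inv, norm_inv, Complex.norm_real,
      Complex.norm_real, Real.norm_of_nonneg (by positivity), Real.norm_of_nonneg (by positivity),
      inv_mul_le_iff₀ (by positivity), inv_mul_le_iff₀ (by positivity)] at h1
    exact h1
  calc mnorm n (multAmp φ n v w) ≤ mnorm n v * (mnorm n w * mbNorm φ) := by
        refine le_mul_of_forall_pos (by positivity) fun ε hε => ?_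
        rw [mul_left_comm]
        exact le_mul_of_forall_pos (by positivity) fun δ hδ => key ε hε δ hδ
    _ = _ := by ring

variable (X) in
/-- The linear map `φ ↦ φ_(m)(v, w)`. -/
def multAmpHom {m : ℕ} (v : Matrix (Fin m) (Fin m) V) (w : Matrix (Fin m) (Fin m) W) :
    (V →ₗ[ℂ] W →ₗ[ℂ] X) →ₗ[ℂ] Matrix (Fin m) (Fin m) X where
  toFun φ := multAmp φ m v w
  map_add' φ ψ := by ext; simp [multAmp, Finset.sum_add_distrib]
  map_smul' c φ := by ext; simp [multAmp, Finset.smul_sum]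

variable (X) in
/-- The linear map `φ ↦ φ_m(v, w)`. -/
def jointAmpHom {m : ℕ} (v : Matrix (Fin m) (Fin m) V) (w : Matrix (Fin m) (Fin m) W) :
    (V →ₗ[ℂ] W →ₗ[ℂ] X) →ₗ[ℂ] Matrix (Fin (m * m)) (Fin (m * m)) X where
  toFun φ := jointAmp φ m v w
  map_add' φ ψ := by ext; simp [jointAmp]
  map_smul' c φ := by ext; simp [jointAmp]

omit [MatrixNorm V] [MatrixNorm W] in
-- Interchanging the two matrix levels identifies `M_n(M_m(X))` with `M_m(M_n(X))`. Thus the norm of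
-- `MB(V × W, M_n(X))` is seen as a supremum of pulled-back norms.
lemma mnorm_map_multAmpHom (hX : IsMatSeminorm (mnorm (E := X))) {n m : ℕ}
    (φ : Matrix (Fin n) (Fin n) (V →ₗ[ℂ] W →ₗ[ℂ] X)) (v : Matrix (Fin m) (Fin m) V)
    (w : Matrix (Fin m) (Fin m) W) :
    mnorm n (φ.map (multAmpHom X v w)) = mnorm m (multAmp (assemble φ) m v w) := by
  rw [← mnorm_transpose hX]
  congr 1
  ext i j a b
  simp [multAmpHom, multAmp, Matrix.sum_apply, assemble_apply]

omit [MatrixNorm V] [MatrixNorm W] in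
lemma mnorm_map_jointAmpHom (hX : IsMatSeminorm (mnorm (E := X))) {n m : ℕ}
    (φ : Matrix (Fin n) (Fin n) (V →ₗ[ℂ] W →ₗ[ℂ] X)) (v : Matrix (Fin m) (Fin m) V)
    (w : Matrix (Fin m) (Fin m) W) :
    mnorm n (φ.map (jointAmpHom X v w)) = mnorm (m * m) (jointAmp (assemble φ) m v w) := by
  rw [← mnorm_transpose hX]
  congr 1

/-- Without this boundedness the `sSup` in the matrix norm of `MB` could take the default value `0`.
-/
lemma IsMB.assemble (hX : IsMatSeminorm (mnorm (E := X))) {n : ℕ}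
    {φ : Matrix (Fin n) (Fin n) (V →ₗ[ℂ] W →ₗ[ℂ] X)} (hφ : ∀ i j, IsMB (φ i j)) :
    IsMB (assemble φ) := by
  refine ⟨∑ i, ∑ j, mbNorm (φ i j), ?_⟩
  rintro t ⟨m, v, w, hv, hw, rfl⟩
  rw [← mnorm_map_multAmpHom hX]
  refine ((hX.matrix m).le_sum_entries _).trans (Finset.sum_le_sum fun i _ =>
    Finset.sum_le_sum fun j _ => ?_)
  rw [mnorm_one_matrix hX]
  exact (hφ i j).mnorm_multAmp_le_of_le_one hv hw

/-! ### Multiplicatively bounded maps are jointly completely bounded -/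

omit [MatrixNorm V] [MatrixNorm W] [MatrixNorm X] in
lemma apply_ite_zero_ite_zero (φ : V →ₗ[ℂ] W →ₗ[ℂ] X) (p q : Prop) [Decidable p] [Decidable q]
    (v : V) (w : W) :
    φ (if p then v else 0) (if q then w else 0) = if p then (if q then φ v w else 0) else 0 := by
  split_ifs <;> simp

omit [MatrixNorm V] [MatrixNorm W] [MatrixNorm X] in
-- In the sum over the middle index the Kronecker deltas of `v ⊗ 1` and `1 ⊗ w` leave a single term.
lemma jointAmp_eq_multAmp (φ : V →ₗ[ℂ] W →ₗ[ℂ] X) (n : ℕ) (v : Matrix (Fin n) (Fin n) V)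
    (w : Matrix (Fin n) (Fin n) W) :
    jointAmp φ n v w = multAmp φ (n * n) (amplify v n) (amplifyLeft n w) := by
  ext a b
  obtain ⟨⟨a, a'⟩, rfl⟩ := finProdFinEquiv.surjective a
  obtain ⟨⟨b, b'⟩, rfl⟩ := finProdFinEquiv.surjective b
  simp only [multAmp, Matrix.of_apply]
  rw [← finProdFinEquiv.sum_comp, Fintype.sum_prod_type]
  simp [jointAmp, amplify, amplifyLeft, apply_ite_zero_ite_zero]

omit [MatrixNorm V] [MatrixNorm W] [MatrixNorm X] in
-- The amplifications act on different tensor legs, so the product taken in the other order has the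
-- same entries.
lemma jointAmp_eq_multAmp_flip (φ : V →ₗ[ℂ] W →ₗ[ℂ] X) (n : ℕ) (v : Matrix (Fin n) (Fin n) V)
    (w : Matrix (Fin n) (Fin n) W) :
    jointAmp φ n v w = multAmp φ.flip (n * n) (amplifyLeft n w) (amplify v n) := by
  ext a b
  obtain ⟨⟨a, a'⟩, rfl⟩ := finProdFinEquiv.surjective a
  obtain ⟨⟨b, b'⟩, rfl⟩ := finProdFinEquiv.surjective b
  simp only [multAmp, Matrix.of_apply]
  rw [← finProdFinEquiv.sum_comp, Fintype.sum_prod_type]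
  simp [jointAmp, amplify, amplifyLeft, apply_ite_zero_ite_zero]

lemma IsMB.mnorm_jointAmp_le (hV : IsMatSeminorm (mnorm (E := V)))
    (hW : IsMatSeminorm (mnorm (E := W))) {φ : V →ₗ[ℂ] W →ₗ[ℂ] X} (hφ : IsMB φ) {n : ℕ}
    {v : Matrix (Fin n) (Fin n) V} {w : Matrix (Fin n) (Fin n) W} (hv : mnorm n v ≤ 1)
    (hw : mnorm n w ≤ 1) : mnorm (n * n) (jointAmp φ n v w) ≤ mbNorm φ := by
  rw [jointAmp_eq_multAmp]
  exact hφ.mnorm_multAmp_le_of_le_one ((mnorm_amplify_le hV v n).trans hv)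
    ((mnorm_amplifyLeft_le hW n w).trans hw)

lemma IsMB.mnorm_jointAmp_flip_le (hV : IsMatSeminorm (mnorm (E := V)))
    (hW : IsMatSeminorm (mnorm (E := W))) {φ : V →ₗ[ℂ] W →ₗ[ℂ] X} (hφ : IsMB φ.flip) {n : ℕ}
    {v : Matrix (Fin n) (Fin n) V} {w : Matrix (Fin n) (Fin n) W} (hv : mnorm n v ≤ 1)
    (hw : mnorm n w ≤ 1) : mnorm (n * n) (jointAmp φ n v w) ≤ mbNorm φ.flip := by
  rw [jointAmp_eq_multAmp_flip]
  exact hφ.mnorm_multAmp_le_of_le_one ((mnorm_amplifyLeft_le hW n w).trans hw)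
    ((mnorm_amplify_le hV v n).trans hv)

end Bilinear

/-! ### The matrix norms of `MB` and `ᵗMB` -/

lemma OperatorSpace.isMatSeminorm (V : Type*) [OperatorSpace V] :
    IsMatSeminorm (mnorm (E := V)) :=
  OperatorSpace.isOperatorSpaceNorm.isMatSeminorm

section Spaces

variable {V W X : Type u} [OperatorSpace V] [OperatorSpace W] [OperatorSpace X]

lemma isMB_assemble {n : ℕ} (φ : Matrix (Fin n) (Fin n) (MB V W X)) :
    IsMB (assemble (φ.map fun ψ => (ψ : V →ₗ[ℂ] W →ₗ[ℂ] X))) :=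
  IsMB.assemble (OperatorSpace.isMatSeminorm X) fun i j => (φ i j).2

lemma mnorm_MB {n : ℕ} (φ : Matrix (Fin n) (Fin n) (MB V W X)) :
    mnorm n φ = mbNorm (assemble (φ.map fun ψ => (ψ : V →ₗ[ℂ] W →ₗ[ℂ] X))) := rfl

/-- The transposition `ᵗMB(W × V, X) → MB(W × V, X)`. -/
def tMBFlip : tMB V W X →ₗ[ℂ] MB W V X where
  toFun φ := ⟨(φ : V →ₗ[ℂ] W →ₗ[ℂ] X).flip, φ.2⟩
  map_add' _ _ := rfl
  map_smul' _ _ := rfl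

/-- The transposition `MB(V × W, X) → ᵗMB(V × W, X)`. -/
def MBFlip : MB V W X →ₗ[ℂ] tMB W V X where
  toFun φ := ⟨(φ : V →ₗ[ℂ] W →ₗ[ℂ] X).flip, φ.2⟩
  map_add' _ _ := rfl
  map_smul' _ _ := rfl

lemma mnorm_tMB {n : ℕ} (φ : Matrix (Fin n) (Fin n) (tMB V W X)) :
    mnorm n φ = mnorm n (φ.map tMBFlip) := rfl

lemma mnorm_map_MBFlip {n : ℕ} (φ : Matrix (Fin n) (Fin n) (MB V W X)) :
    mnorm n (φ.map MBFlip) = mnorm n φ := rfl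

/-- The linear map `φ ↦ φ_(m)(v, w)` on `MB(V × W, X)`. -/
def multAmpMB {m : ℕ} (v : Matrix (Fin m) (Fin m) V) (w : Matrix (Fin m) (Fin m) W) :
    MB V W X →ₗ[ℂ] Matrix (Fin m) (Fin m) X :=
  (multAmpHom X v w).comp (MB V W X).subtype

lemma isMatSeminorm_MB : IsMatSeminorm (mnorm (E := MB V W X)) := by
  have hX := OperatorSpace.isMatSeminorm X
  refine IsMatSeminorm.of_isSup
    (ι := Σ m : ℕ, {v : Matrix (Fin m) (Fin m) V // mnorm m v ≤ 1} ×
      {w : Matrix (Fin m) (Fin m) W // mnorm m w ≤ 1})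
    (fun i => IsMatSeminorm.comp (E := MB V W X) (F := Matrix (Fin i.1) (Fin i.1) X)
      (hX.matrix i.1) (multAmpMB (X := X) i.2.1.1 i.2.2.1)) ?_ ?_ ?_
  · intro n φ
    exact mbNorm_nonneg (hX.matrix n) _
  · rintro ⟨m, ⟨v, hv⟩, ⟨w, hw⟩⟩ n φ
    change mnorm n ((φ.map fun ψ => (ψ : V →ₗ[ℂ] W →ₗ[ℂ] X)).map (multAmpHom X v w)) ≤ _
    rw [mnorm_map_multAmpHom hX, mnorm_MB]
    exact (isMB_assemble φ).mnorm_multAmp_le_of_le_one hv hw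
  · intro n φ C hC h
    refine Real.sSup_le ?_ hC
    rintro t ⟨m, v, w, hv, hw, rfl⟩
    rw [← mnorm_map_multAmpHom hX]
    exact h ⟨m, ⟨v, hv⟩, ⟨w, hw⟩⟩

lemma isMatSeminorm_tMB : IsMatSeminorm (mnorm (E := tMB V W X)) := by
  have h := isMatSeminorm_MB (V := W) (W := V) (X := X)
  have h1 := IsMatSeminorm.comp (E := tMB V W X) h (tMBFlip (V := V) (W := W) (X := X))
  exact h1

end Spaces

/-! ### The `ℓ₁`-direct sum -/

section L1

variable {E F E' F' : Type u} [AddCommGroup E] [Module ℂ E] [MatrixNorm E]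
  [AddCommGroup F] [Module ℂ F] [MatrixNorm F] [AddCommGroup E'] [Module ℂ E'] [MatrixNorm E']
  [AddCommGroup F'] [Module ℂ F'] [MatrixNorm F']

lemma l1SumNorm_nonneg {n : ℕ} (x : Matrix (Fin n) (Fin n) E) (y : Matrix (Fin n) (Fin n) F) :
    0 ≤ l1SumNorm n x y :=
  Real.sSup_nonneg fun t ht => by
    obtain ⟨Z, _, f, g, -, -, rfl⟩ := ht
    exact (OperatorSpace.isMatSeminorm Z).nonneg _ _

lemma mnorm_add_le_l1SumNorm (hE : IsMatSeminorm (mnorm (E := E)))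
    (hF : IsMatSeminorm (mnorm (E := F))) {Z : Type u} [OperatorSpace Z] {f : E →ₗ[ℂ] Z}
    {g : F →ₗ[ℂ] Z} (hf : IsCompleteContraction f) (hg : IsCompleteContraction g) {n : ℕ}
    (x : Matrix (Fin n) (Fin n) E) (y : Matrix (Fin n) (Fin n) F) :
    mnorm n (x.map f + y.map g) ≤ l1SumNorm n x y := by
  -- This bound, uniform in `Z`, `f` and `g`, makes the `sSup` a genuine supremum.
  refine le_csSup ⟨mnorm n x + mnorm n y, ?_⟩ ⟨Z, inferInstance, f, g, hf, hg, rfl⟩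
  rintro t ⟨Z, _, f, g, hf, hg, rfl⟩
  have hZ := OperatorSpace.isMatSeminorm Z
  exact (hZ.add_le _ _ _).trans (add_le_add (hf.mnorm_map_le hE hZ x) (hg.mnorm_map_le hF hZ y))

lemma l1SumNorm_le {n : ℕ} {x : Matrix (Fin n) (Fin n) E} {y : Matrix (Fin n) (Fin n) F} {C : ℝ}
    (hC : 0 ≤ C) (h : ∀ (Z : Type u) [OperatorSpace Z] (f : E →ₗ[ℂ] Z) (g : F →ₗ[ℂ] Z),
      IsCompleteContraction f → IsCompleteContraction g → mnorm n (x.map f + y.map g) ≤ C) :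
    l1SumNorm n x y ≤ C := by
  refine Real.sSup_le ?_ hC
  rintro t ⟨Z, _, f, g, hf, hg, rfl⟩
  exact h Z f g hf hg

lemma isMatSeminorm_l1SumNorm (hE : IsMatSeminorm (mnorm (E := E)))
    (hF : IsMatSeminorm (mnorm (E := F))) :
    IsMatSeminorm fun n (z : Matrix (Fin n) (Fin n) (E × F)) =>
      l1SumNorm n (z.map Prod.fst) (z.map Prod.snd) := by
  have key : ∀ (Z : Type u) [OperatorSpace Z] (f : E →ₗ[ℂ] Z) (g : F →ₗ[ℂ] Z) (n : ℕ)
      (z : Matrix (Fin n) (Fin n) (E × F)),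
      z.map (f.coprod g) = (z.map Prod.fst).map f + (z.map Prod.snd).map g := by
    intros
    ext
    simp
  refine IsMatSeminorm.of_isSup
    (ι := {p : Σ (Z : Type u) (_ : OperatorSpace Z), (E →ₗ[ℂ] Z) × (F →ₗ[ℂ] Z) //
      letI := p.2.1
      IsCompleteContraction p.2.2.1 ∧ IsCompleteContraction p.2.2.2})
    (M := fun p n z => letI := p.1.2.1; mnorm n (z.map (p.1.2.2.1.coprod p.1.2.2.2)))
    ?_ (fun _ _ => l1SumNorm_nonneg _ _) ?_ ?_
  · rintro ⟨⟨Z, _, f, g⟩, hf, hg⟩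
    exact IsMatSeminorm.comp (E := E × F) (OperatorSpace.isMatSeminorm Z) (f.coprod g)
  · rintro ⟨⟨Z, _, f, g⟩, hf, hg⟩ n z
    simp only [key]
    exact mnorm_add_le_l1SumNorm hE hF hf hg _ _
  · intro n z C hC h
    refine l1SumNorm_le hC fun Z _ f g hf hg => ?_
    rw [← key]
    exact h ⟨⟨Z, _, f, g⟩, hf, hg⟩

lemma l1SumNorm_swap_le (hE : IsMatSeminorm (mnorm (E := E)))
    (hF : IsMatSeminorm (mnorm (E := F))) {n : ℕ} (x : Matrix (Fin n) (Fin n) E)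
    (y : Matrix (Fin n) (Fin n) F) : l1SumNorm n y x ≤ l1SumNorm n x y :=
  l1SumNorm_le (l1SumNorm_nonneg _ _) fun Z _ f g hf hg => by
    rw [add_comm]
    exact mnorm_add_le_l1SumNorm hE hF hg hf x y

/-- If `f`, `g` are complete contractions, so are `(C + ε)⁻¹ f ∘ A` and `(C + ε)⁻¹ g ∘ B`, and these
compete in the supremum for `(x, y)`. The `ε` covers `C = 0`. -/
lemma l1SumNorm_map_le (hE : IsMatSeminorm (mnorm (E := E)))
    (hF : IsMatSeminorm (mnorm (E := F))) (hE' : IsMatSeminorm (mnorm (E := E')))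
    (hF' : IsMatSeminorm (mnorm (E := F'))) {A : E →ₗ[ℂ] E'} {B : F →ₗ[ℂ] F'} {C : ℝ}
    (hC : 0 ≤ C)
    (hA : ∀ n (x : Matrix (Fin n) (Fin n) E), mnorm n (x.map A) ≤ C * mnorm n x)
    (hB : ∀ n (y : Matrix (Fin n) (Fin n) F), mnorm n (y.map B) ≤ C * mnorm n y) {n : ℕ}
    (x : Matrix (Fin n) (Fin n) E) (y : Matrix (Fin n) (Fin n) F) :
    l1SumNorm n (x.map A) (y.map B) ≤ C * l1SumNorm n x y := by
  have hl := l1SumNorm_nonneg x y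
  refine l1SumNorm_le (by positivity) fun Z _ f g hf hg => le_mul_of_forall_pos hl fun ε hε => ?_
  have hZ := OperatorSpace.isMatSeminorm Z
  have hK : 0 < C + ε := by positivity
  have hKn : ‖(((C + ε : ℝ) : ℂ))⁻¹‖ = (C + ε)⁻¹ := by
    rw [norm_inv, Complex.norm_real, Real.norm_of_nonneg hK.le]
  have cc : ∀ {G G' : Type u} [AddCommGroup G] [Module ℂ G] [MatrixNorm G] [AddCommGroup G']
      [Module ℂ G'] [MatrixNorm G'] {D : G →ₗ[ℂ] G'} {k : G' →ₗ[ℂ] Z},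
      IsMatSeminorm (mnorm (E := G')) → IsCompleteContraction k →
      (∀ n (x : Matrix (Fin n) (Fin n) G), mnorm n (x.map D) ≤ C * mnorm n x) →
      IsCompleteContraction ((((C + ε : ℝ) : ℂ))⁻¹ • k.comp D) := by
    intro G G' _ _ _ _ _ _ D k hG' hk hD
    refine isCompleteContraction_of_le fun m v hv => ?_
    have h1 : v.map ((((C + ε : ℝ) : ℂ))⁻¹ • k.comp D)
        = (((C + ε : ℝ) : ℂ))⁻¹ • (v.map D).map k := rfl
    rw [h1, hZ.smul_eq, hKn, inv_mul_le_one₀ hK]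
    calc mnorm m ((v.map D).map k) ≤ mnorm m (v.map D) := hk.mnorm_map_le hG' hZ _
      _ ≤ C * mnorm m v := hD m v
      _ ≤ C * 1 := by gcongr
      _ ≤ C + ε := by linarith
  have h := mnorm_add_le_l1SumNorm hE hF (cc hE' hf hA) (cc hF' hg hB) x y
  have h1 : x.map ((((C + ε : ℝ) : ℂ))⁻¹ • f.comp A) + y.map ((((C + ε : ℝ) : ℂ))⁻¹ • g.comp B)
      = (((C + ε : ℝ) : ℂ))⁻¹ • ((x.map A).map f + (y.map B).map g) := by
    rw [smul_add]
    rfl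
  rwa [h1, hZ.smul_eq, hKn, inv_mul_le_iff₀ hK] at h

end L1

/-! ### The symmetrized norm -/

section SMB

variable {V W X : Type u} [OperatorSpace V] [OperatorSpace W] [OperatorSpace X]

/-- The quotient map `(φ₁, φ₂) ↦ φ₁ + φ₂`. -/
def sumHom : MB V W X × tMB V W X →ₗ[ℂ] SMB V W X :=
  (Submodule.inclusion le_sup_left).coprod (Submodule.inclusion le_sup_right)

lemma exists_decomposition {n : ℕ} (φ : Matrix (Fin n) (Fin n) (SMB V W X)) :
    ∃ (φ₁ : Matrix (Fin n) (Fin n) (MB V W X)) (φ₂ : Matrix (Fin n) (Fin n) (tMB V W X)),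
      ∀ i j, (φ i j : V →ₗ[ℂ] W →ₗ[ℂ] X) = φ₁ i j + φ₂ i j := by
  have h : ∀ i j, ∃ (a : MB V W X) (b : tMB V W X), (φ i j : V →ₗ[ℂ] W →ₗ[ℂ] X) = a + b := by
    intro i j
    obtain ⟨a, ha, b, hb, hab⟩ := Submodule.mem_sup.mp (φ i j).2
    exact ⟨⟨a, ha⟩, ⟨b, hb⟩, hab.symm⟩
  choose a b hab using h
  exact ⟨a, b, hab⟩

lemma smbMatrixNorm_nonneg {n : ℕ} (φ : Matrix (Fin n) (Fin n) (SMB V W X)) :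
    0 ≤ smbMatrixNorm V W X n φ :=
  Real.sInf_nonneg fun t ht => by
    obtain ⟨a, b, -, rfl⟩ := ht
    exact l1SumNorm_nonneg _ _

lemma smbMatrixNorm_le {n : ℕ} {φ : Matrix (Fin n) (Fin n) (SMB V W X)}
    (φ₁ : Matrix (Fin n) (Fin n) (MB V W X)) (φ₂ : Matrix (Fin n) (Fin n) (tMB V W X))
    (h : ∀ i j, (φ i j : V →ₗ[ℂ] W →ₗ[ℂ] X) = φ₁ i j + φ₂ i j) :
    smbMatrixNorm V W X n φ ≤ l1SumNorm n φ₁ φ₂ := by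
  refine csInf_le ⟨0, ?_⟩ ⟨φ₁, φ₂, h, rfl⟩
  rintro t ⟨a, b, -, rfl⟩
  exact l1SumNorm_nonneg _ _

lemma le_smbMatrixNorm {n : ℕ} {φ : Matrix (Fin n) (Fin n) (SMB V W X)} {C : ℝ}
    (h : ∀ (φ₁ : Matrix (Fin n) (Fin n) (MB V W X)) (φ₂ : Matrix (Fin n) (Fin n) (tMB V W X)),
      (∀ i j, (φ i j : V →ₗ[ℂ] W →ₗ[ℂ] X) = φ₁ i j + φ₂ i j) → C ≤ l1SumNorm n φ₁ φ₂) :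
    C ≤ smbMatrixNorm V W X n φ := by
  -- A decomposition must exist, since the infimum of the empty set would be `0`.
  obtain ⟨a, b, hab⟩ := exists_decomposition φ
  refine le_csInf ⟨_, a, b, hab, rfl⟩ ?_
  rintro t ⟨a, b, hab, rfl⟩
  exact h a b hab

lemma exists_l1SumNorm_le {n : ℕ} (φ : Matrix (Fin n) (Fin n) (SMB V W X)) {ε : ℝ}
    (hε : 0 < ε) : ∃ (φ₁ : Matrix (Fin n) (Fin n) (MB V W X))
      (φ₂ : Matrix (Fin n) (Fin n) (tMB V W X)),
      (∀ i j, (φ i j : V →ₗ[ℂ] W →ₗ[ℂ] X) = φ₁ i j + φ₂ i j) ∧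
        l1SumNorm n φ₁ φ₂ ≤ smbMatrixNorm V W X n φ + ε := by
  by_contra! h
  have := le_smbMatrixNorm fun a b hab => (h a b hab).le
  linarith

lemma isMatSeminorm_smbMatrixNorm : IsMatSeminorm (smbMatrixNorm V W X) := by
  have hMB := isMatSeminorm_MB (V := V) (W := W) (X := X)
  have htMB := isMatSeminorm_tMB (V := V) (W := W) (X := X)
  refine IsMatSeminorm.of_isInf (E := MB V W X × tMB V W X) (F := SMB V W X)
    (isMatSeminorm_l1SumNorm (E := MB V W X) (F := tMB V W X) hMB htMB) sumHom
    (fun _ _ => smbMatrixNorm_nonneg _) ?_ ?_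
  · intro n x
    exact smbMatrixNorm_le _ _ fun i j => rfl
  · intro n φ ε hε
    obtain ⟨a, b, hab, h⟩ := exists_l1SumNorm_le φ hε
    refine ⟨Matrix.of fun i j => (a i j, b i j), ?_, h⟩
    ext i j : 2
    exact (hab i j).symm

/-- The restriction of `jointAmpHom` to `MB(V × W, X)`. -/
def jointAmpMB {m : ℕ} (v : Matrix (Fin m) (Fin m) V) (w : Matrix (Fin m) (Fin m) W) :
    MB V W X →ₗ[ℂ] Matrix (Fin (m * m)) (Fin (m * m)) X :=
  (jointAmpHom X v w).comp (MB V W X).subtype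

/-- The restriction of `jointAmpHom` to `ᵗMB(W × V, X)`. -/
def jointAmptMB {m : ℕ} (v : Matrix (Fin m) (Fin m) V) (w : Matrix (Fin m) (Fin m) W) :
    tMB V W X →ₗ[ℂ] Matrix (Fin (m * m)) (Fin (m * m)) X :=
  (jointAmpHom X v w).comp (tMB V W X).subtype

lemma isCompleteContraction_jointAmpMB {m : ℕ} {v : Matrix (Fin m) (Fin m) V}
    {w : Matrix (Fin m) (Fin m) W} (hv : mnorm m v ≤ 1) (hw : mnorm m w ≤ 1) :
    IsCompleteContraction (E := MB V W X) (F := Matrix (Fin (m * m)) (Fin (m * m)) X)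
      (jointAmpMB v w) := by
  refine isCompleteContraction_of_le fun n φ hφ => ?_
  change mnorm n ((φ.map fun ψ => (ψ : V →ₗ[ℂ] W →ₗ[ℂ] X)).map (jointAmpHom X v w)) ≤ 1
  rw [mnorm_map_jointAmpHom (OperatorSpace.isMatSeminorm X)]
  exact ((isMB_assemble φ).mnorm_jointAmp_le (OperatorSpace.isMatSeminorm V)
    (OperatorSpace.isMatSeminorm W) hv hw).trans hφ

lemma isCompleteContraction_jointAmptMB {m : ℕ} {v : Matrix (Fin m) (Fin m) V}
    {w : Matrix (Fin m) (Fin m) W} (hv : mnorm m v ≤ 1) (hw : mnorm m w ≤ 1) :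
    IsCompleteContraction (E := tMB V W X) (F := Matrix (Fin (m * m)) (Fin (m * m)) X)
      (jointAmptMB v w) := by
  refine isCompleteContraction_of_le fun n φ hφ => ?_
  change mnorm n ((φ.map fun ψ => (ψ : V →ₗ[ℂ] W →ₗ[ℂ] X)).map (jointAmpHom X v w)) ≤ 1
  rw [mnorm_map_jointAmpHom (OperatorSpace.isMatSeminorm X)]
  have h : IsMB (assemble (φ.map fun ψ => (ψ : V →ₗ[ℂ] W →ₗ[ℂ] X))).flip :=
    isMB_assemble (φ.map tMBFlip)
  exact (h.mnorm_jointAmp_flip_le (OperatorSpace.isMatSeminorm V)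
    (OperatorSpace.isMatSeminorm W) hv hw).trans hφ

lemma mnorm_jointAmp_le_smbMatrixNorm {n m : ℕ} (φ : Matrix (Fin n) (Fin n) (SMB V W X))
    {v : Matrix (Fin m) (Fin m) V} {w : Matrix (Fin m) (Fin m) W} (hv : mnorm m v ≤ 1)
    (hw : mnorm m w ≤ 1) :
    mnorm (m * m) (jointAmp (assemble (φ.map fun ψ => (ψ : V →ₗ[ℂ] W →ₗ[ℂ] X))) m v w)
      ≤ smbMatrixNorm V W X n φ := by
  refine le_smbMatrixNorm fun a b hab => ?_
  rw [← mnorm_map_jointAmpHom (OperatorSpace.isMatSeminorm X)]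
  -- The common target `Z` of the two complete contractions is `M_{m²}(X)`.
  let := matrixOperatorSpace (OperatorSpace.isOperatorSpaceNorm (V := X)) (m * m)
  have hMB := isMatSeminorm_MB (V := V) (W := W) (X := X)
  have htMB := isMatSeminorm_tMB (V := V) (W := W) (X := X)
  have h1 := isCompleteContraction_jointAmpMB (X := X) hv hw
  have h2 := isCompleteContraction_jointAmptMB (X := X) hv hw
  have h := mnorm_add_le_l1SumNorm (E := MB V W X) (F := tMB V W X)
    (Z := Matrix (Fin (m * m)) (Fin (m * m)) X) hMB htMB h1 h2 a b
  refine le_trans (le_of_eq ?_) h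
  congr 1
  ext i j : 2
  simp only [Matrix.map_apply, hab, map_add]
  rfl

end SMB

/-! ### The ideal axioms and symmetry for `SMB` -/

section Ideal

variable {V W X : Type u} [OperatorSpace V] [OperatorSpace W] [OperatorSpace X]

lemma isJCB_of_mem_SMB {φ : V →ₗ[ℂ] W →ₗ[ℂ] X} (hφ : φ ∈ SMB V W X) : IsJCB φ := by
  obtain ⟨a, ha, b, hb, rfl⟩ := Submodule.mem_sup.mp hφ
  have hV := OperatorSpace.isMatSeminorm V
  have hW := OperatorSpace.isMatSeminorm W
  refine ⟨mbNorm a + mbNorm b.flip, ?_⟩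
  rintro t ⟨n, v, w, hv, hw, rfl⟩
  have h : jointAmp (a + b) n v w = jointAmp a n v w + jointAmp b n v w :=
    map_add (jointAmpHom X v w) a b
  rw [h]
  exact ((OperatorSpace.isMatSeminorm X).add_le _ _ _).trans (add_le_add
    (IsMB.mnorm_jointAmp_le hV hW ha hv hw) (IsMB.mnorm_jointAmp_flip_le hV hW hb hv hw))

lemma jcbMatrixNorm_le_smbMatrixNorm {n : ℕ} (φ : Matrix (Fin n) (Fin n) (SMB V W X)) :
    jcbMatrixNorm n (φ.map fun ψ => (ψ : V →ₗ[ℂ] W →ₗ[ℂ] X)) ≤ smbMatrixNorm V W X n φ := by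
  refine Real.sSup_le ?_ (smbMatrixNorm_nonneg φ)
  rintro t ⟨m, v, w, hv, hw, rfl⟩
  exact mnorm_jointAmp_le_smbMatrixNorm φ hv hw

lemma isOperatorSpaceNorm_smbMatrixNorm : IsOperatorSpaceNorm (smbMatrixNorm V W X) := by
  refine isMatSeminorm_smbMatrixNorm.isOperatorSpaceNorm fun n φ hφ => ?_
  have hX := OperatorSpace.isOperatorSpaceNorm (V := X)
  have hV := OperatorSpace.isMatSeminorm V
  have hW := OperatorSpace.isMatSeminorm W
  ext i j v w
  -- Dividing by the norm plus `1` puts arbitrary vectors into the unit balls, even zero vectors;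
  -- these nonzero scalars cancel in `h1`.
  have h := mnorm_jointAmp_le_smbMatrixNorm φ
    (hV.mnorm_smul_inv_le (Matrix.of fun _ _ : Fin 1 => v) one_pos)
    (hW.mnorm_smul_inv_le (Matrix.of fun _ _ : Fin 1 => w) one_pos)
  have hv := hV.nonneg 1 (Matrix.of fun _ _ => v)
  have hw := hW.nonneg 1 (Matrix.of fun _ _ => w)
  set c : ℝ := mnorm 1 (Matrix.of fun _ _ : Fin 1 => v) + 1
  set d : ℝ := mnorm 1 (Matrix.of fun _ _ : Fin 1 => w) + 1
  have hc : (c : ℂ) ≠ 0 := Complex.ofReal_ne_zero.mpr (by positivity)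
  have hd : (d : ℂ) ≠ 0 := Complex.ofReal_ne_zero.mpr (by positivity)
  rw [hφ] at h
  have h0 := (hX.matrix n).eq_zero _ _ (le_antisymm h ((hX.matrix n).nonneg _ _))
  have h1 := congrFun (congrFun (congrFun (congrFun h0 (finProdFinEquiv (0, 0)))
    (finProdFinEquiv (0, 0))) i) j
  simp only [jointAmp, Matrix.reindex_apply, Matrix.submatrix_apply, Equiv.symm_apply_apply,
    Matrix.of_apply, Matrix.smul_apply, map_smul, LinearMap.smul_apply, assemble_apply,
    Matrix.map_apply, Matrix.zero_apply, smul_eq_zero, inv_eq_zero, hc, hd, false_or] at h1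
  simpa using h1

/-! ### Finite type maps -/

lemma scalarNorm_column_le {n : ℕ} (a : Fin n → ℂ) :
    scalarNorm (Matrix.of fun i (_ : Fin 1) => a i) ≤ √(∑ i, ‖a i‖ ^ 2) := by
  refine scalarNorm_le _ (Real.sqrt_nonneg _) fun x => ?_
  rw [Real.sq_sqrt (by positivity)]
  simp [Matrix.mulVec, dotProduct, mul_pow, Finset.sum_mul]

lemma scalarNorm_row_le {n : ℕ} (a : Fin n → ℂ) :
    scalarNorm (Matrix.of fun (_ : Fin 1) i => a i) ≤ √(∑ i, ‖a i‖ ^ 2) := by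
  have h : (Matrix.of fun (_ : Fin 1) i => a i)
      = (Matrix.of fun i (_ : Fin 1) => star (a i)).conjTranspose := by
    ext
    simp
  rw [h, scalarNorm_conjTranspose]
  refine (scalarNorm_column_le _).trans (le_of_eq ?_)
  simp

/-- A bounded functional is completely bounded, with the same norm. -/
lemma scalarNorm_map_functional_le (f : V →L[ℂ] ℂ) {n : ℕ} (v : Matrix (Fin n) (Fin n) V) :
    scalarNorm (v.map f) ≤ ‖f‖ * mnorm n v := by
  have hV := OperatorSpace.isMatSeminorm V
  have hv := hV.nonneg n v
  refine scalarNorm_le _ (by positivity) fun x => ?_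
  set z := (v.map f).mulVec x with hz
  set S := ∑ i, ‖z i‖ ^ 2 with hS
  set R := ∑ j, ‖x j‖ ^ 2 with hR
  have hS0 : 0 ≤ S := by positivity
  have hR0 : 0 ≤ R := by positivity
  -- With `z = f(v) x`, the vector `u = z* v x` satisfies `f u = ‖z‖² = S`, while (M2) bounds `‖u‖`
  -- by `√S ‖v‖ √R`. Cancelling `√S` gives the claim.
  let u : V := ∑ k, ∑ l, (star (z k) * x l) • v k l
  have h1 : (S : ℂ) = f u := by
    simp only [u, map_sum, map_smul, smul_eq_mul, hS, Complex.ofReal_sum]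
    refine Finset.sum_congr rfl fun k _ => ?_
    have h2 : z k = ∑ l, f (v k l) * x l := rfl
    calc ((‖z k‖ ^ 2 : ℝ) : ℂ) = star (z k) * z k := by
          rw [Complex.ofReal_pow, ← Complex.conj_mul']
          rfl
      _ = star (z k) * ∑ l, f (v k l) * x l := congrArg (star (z k) * ·) h2
      _ = ∑ l, star (z k) * x l * f (v k l) := by
          rw [Finset.mul_sum]
          exact Finset.sum_congr rfl fun l _ => by ring
  have h2 : ‖u‖ ≤ √S * mnorm n v * √R := by
    rw [← OperatorSpace.mnorm_one u]
    have h3 : (Matrix.of fun _ _ : Fin 1 => u) = sandwich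
        (Matrix.of fun (_ : Fin 1) i => star (z i)) v (Matrix.of fun i (_ : Fin 1) => x i) := by
      ext
      simp [sandwich, u]
    rw [h3]
    refine (hV.sandwich_le _ _ _ _ _).trans ?_
    have h4 : scalarNorm (Matrix.of fun (_ : Fin 1) i => star (z i)) ≤ √S := by
      simpa using scalarNorm_row_le fun i => star (z i)
    have h5 := scalarNorm_column_le x
    have h6 := scalarNorm_nonneg (Matrix.of fun i (_ : Fin 1) => x i)
    gcongr
  have h3 : S ≤ ‖f‖ * mnorm n v * √R * √S := by
    calc S = ‖(S : ℂ)‖ := by rw [Complex.norm_real, Real.norm_of_nonneg hS0]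
      _ = ‖f u‖ := by rw [h1]
      _ ≤ ‖f‖ * ‖u‖ := f.le_opNorm u
      _ ≤ ‖f‖ * (√S * mnorm n v * √R) := by gcongr
      _ = _ := by ring
  have h4 : √S ≤ ‖f‖ * mnorm n v * √R := by
    rcases (Real.sqrt_nonneg S).eq_or_lt with h | h
    · rw [← h]
      positivity
    · refine le_of_mul_le_mul_right ?_ h
      rwa [Real.mul_self_sqrt hS0]
  calc S = √S ^ 2 := (Real.sq_sqrt hS0).symm
    _ ≤ (‖f‖ * mnorm n v * √R) ^ 2 := by gcongr
    _ = (‖f‖ * mnorm n v) ^ 2 * R := by rw [mul_pow, Real.sq_sqrt hR0]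

lemma mnorm_scalar_le (x : X) (n : ℕ) :
    mnorm n (Matrix.of fun i j : Fin n => if i = j then x else 0) ≤ ‖x‖ := by
  have hX := OperatorSpace.isMatSeminorm X
  have hf : Function.Injective fun i : Fin n => finProdFinEquiv (i, (0 : Fin 1)) :=
    fun i j hij => by simpa using hij
  have h : (Matrix.of fun i j : Fin n => if i = j then x else 0)
      = (amplifyLeft n (Matrix.of fun _ _ : Fin 1 => x)).submatrix
        (fun i => finProdFinEquiv (i, 0)) (fun i => finProdFinEquiv (i, 0)) := by
    ext
    simp [amplifyLeft]
  rw [h, ← OperatorSpace.mnorm_one x]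
  exact (hX.submatrix_le hf hf _).trans (mnorm_amplifyLeft_le hX n _)

lemma isMB_of_finiteType {φ : V →ₗ[ℂ] W →ₗ[ℂ] X} {f : V →L[ℂ] ℂ} {g : W →L[ℂ] ℂ} {x : X}
    (h : ∀ v w, φ v w = (f v * g w) • x) : IsMB φ := by
  refine ⟨‖f‖ * ‖x‖ * ‖g‖, ?_⟩
  rintro t ⟨n, v, w, hv, hw, rfl⟩
  have h1 : multAmp φ n v w
      = sandwich (v.map f) (Matrix.of fun i j : Fin n => if i = j then x else 0) (w.map g) := by
    ext i j
    simp [multAmp, sandwich, h]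
  have h2 : scalarNorm (v.map f) ≤ ‖f‖ :=
    (scalarNorm_map_functional_le f v).trans (mul_le_of_le_one_right (norm_nonneg f) hv)
  have h3 : scalarNorm (w.map g) ≤ ‖g‖ :=
    (scalarNorm_map_functional_le g w).trans (mul_le_of_le_one_right (norm_nonneg g) hw)
  have h4 := mnorm_scalar_le x n
  have h5 := scalarNorm_nonneg (w.map g)
  have h6 := (OperatorSpace.isMatSeminorm X).nonneg n
    (Matrix.of fun i j : Fin n => if i = j then x else 0)
  rw [h1]
  refine ((OperatorSpace.isMatSeminorm X).sandwich_le _ _ _ _ _).trans ?_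
  gcongr

lemma finiteType_le_SMB : finiteType V W X ≤ SMB V W X := by
  refine Submodule.span_le.mpr ?_
  rintro φ ⟨f, g, x, h⟩
  exact Submodule.mem_sup_left (isMB_of_finiteType h)

/-! ### Composition -/

section Comp

variable {U₁ U₂ Y : Type u} [OperatorSpace U₁] [OperatorSpace U₂] [OperatorSpace Y]
  {r₁ : U₁ →ₗ[ℂ] V} {r₂ : U₂ →ₗ[ℂ] W} {s : X →ₗ[ℂ] Y}

/-- The targets are general so that `X'`, `Y'` can be matrix spaces and `s` an entrywise map. -/
lemma mnorm_multAmp_comp_le {X' Y' : Type*} [AddCommGroup X'] [Module ℂ X'] [MatrixNorm X']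
    [AddCommGroup Y'] [Module ℂ Y'] [MatrixNorm Y'] (hX : IsMatSeminorm (mnorm (E := X')))
    {s : X' →ₗ[ℂ] Y'} {K : ℝ} (hK : 0 ≤ K)
    (hs : ∀ n (x : Matrix (Fin n) (Fin n) X'), mnorm n (x.map s) ≤ K * mnorm n x)
    (hr₁ : IsCB r₁) (hr₂ : IsCB r₂) {φ : V →ₗ[ℂ] W →ₗ[ℂ] X'} (hφ : IsMB φ) {n : ℕ}
    {v : Matrix (Fin n) (Fin n) U₁} {w : Matrix (Fin n) (Fin n) U₂} (hv : mnorm n v ≤ 1)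
    (hw : mnorm n w ≤ 1) :
    mnorm n (multAmp ((φ.compl₁₂ r₁ r₂).compr₂ s) n v w)
      ≤ K * cbNorm r₁ * cbNorm r₂ * mbNorm φ := by
  have hV := OperatorSpace.isMatSeminorm V
  have hW := OperatorSpace.isMatSeminorm W
  have h1 : multAmp ((φ.compl₁₂ r₁ r₂).compr₂ s) n v w
      = (multAmp φ n (v.map r₁) (w.map r₂)).map s := by
    ext i j
    simp [multAmp]
  have n1 := cbNorm_nonneg hV r₁
  have n2 := cbNorm_nonneg hW r₂
  have n3 := mbNorm_nonneg hX φ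
  have n4 := hW.nonneg n (w.map r₂)
  have h2 : mnorm n (v.map r₁) ≤ cbNorm r₁ :=
    (hr₁.mnorm_map_le (OperatorSpace.isMatSeminorm U₁) hV v).trans
      (mul_le_of_le_one_right n1 hv)
  have h3 : mnorm n (w.map r₂) ≤ cbNorm r₂ :=
    (hr₂.mnorm_map_le (OperatorSpace.isMatSeminorm U₂) hW w).trans
      (mul_le_of_le_one_right n2 hw)
  rw [h1]
  calc _ ≤ K * mnorm n (multAmp φ n (v.map r₁) (w.map r₂)) := hs _ _
    _ ≤ K * (mbNorm φ * mnorm n (v.map r₁) * mnorm n (w.map r₂)) := by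
        gcongr
        exact hφ.mnorm_multAmp_le hV hW hX _ _
    _ ≤ K * (mbNorm φ * cbNorm r₁ * cbNorm r₂) := by gcongr
    _ = _ := by ring

lemma isMB_comp (hr₁ : IsCB r₁) (hr₂ : IsCB r₂) (hs : IsCB s) {φ : V →ₗ[ℂ] W →ₗ[ℂ] X}
    (hφ : IsMB φ) : IsMB ((φ.compl₁₂ r₁ r₂).compr₂ s) := by
  have hX := OperatorSpace.isMatSeminorm X
  have hY := OperatorSpace.isMatSeminorm Y
  refine ⟨cbNorm s * cbNorm r₁ * cbNorm r₂ * mbNorm φ, ?_⟩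
  rintro t ⟨n, v, w, hv, hw, rfl⟩
  exact mnorm_multAmp_comp_le hX (cbNorm_nonneg hY s) (fun n x => hs.mnorm_map_le hX hY x)
    hr₁ hr₂ hφ hv hw

/-- The map `φ ↦ s ∘ φ ∘ (r₁, r₂)` from `MB(V × W, X)` to `MB(U₁ × U₂, Y)`. -/
def compMB (hr₁ : IsCB r₁) (hr₂ : IsCB r₂) (hs : IsCB s) : MB V W X →ₗ[ℂ] MB U₁ U₂ Y where
  toFun φ := ⟨((φ : V →ₗ[ℂ] W →ₗ[ℂ] X).compl₁₂ r₁ r₂).compr₂ s, isMB_comp hr₁ hr₂ hs φ.2⟩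
  map_add' φ ψ := by ext; simp
  map_smul' c φ := by ext; simp

/-- The map `φ ↦ s ∘ φ ∘ (r₁, r₂)` from `ᵗMB(W × V, X)` to `ᵗMB(U₂ × U₁, Y)`. -/
def comptMB (hr₁ : IsCB r₁) (hr₂ : IsCB r₂) (hs : IsCB s) : tMB V W X →ₗ[ℂ] tMB U₁ U₂ Y where
  toFun φ := ⟨((φ : V →ₗ[ℂ] W →ₗ[ℂ] X).compl₁₂ r₁ r₂).compr₂ s,
    isMB_comp (φ := (φ : V →ₗ[ℂ] W →ₗ[ℂ] X).flip) hr₂ hr₁ hs φ.2⟩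
  map_add' φ ψ := by ext; simp
  map_smul' c φ := by ext; simp

lemma mnorm_map_compMB_le (hr₁ : IsCB r₁) (hr₂ : IsCB r₂) (hs : IsCB s) (n : ℕ)
    (φ : Matrix (Fin n) (Fin n) (MB V W X)) :
    mnorm n (φ.map (compMB hr₁ hr₂ hs)) ≤ cbNorm s * cbNorm r₁ * cbNorm r₂ * mnorm n φ := by
  have hX := OperatorSpace.isMatSeminorm X
  have hY := OperatorSpace.isMatSeminorm Y
  have n1 := cbNorm_nonneg (OperatorSpace.isMatSeminorm V) r₁
  have n2 := cbNorm_nonneg (OperatorSpace.isMatSeminorm W) r₂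
  have n3 := cbNorm_nonneg hY s
  have n4 : 0 ≤ mnorm n φ := isMatSeminorm_MB.nonneg n φ
  refine Real.sSup_le ?_ (by positivity)
  rintro t ⟨m, v, w, hv, hw, rfl⟩
  -- Since `M_k(M_n(X)) = M_{kn}(X)`, the entrywise map inherits the bound `cbNorm s`.
  exact mnorm_multAmp_comp_le (s := s.mapMatrix) (hX.matrix n) n3
    (fun k x => hs.mnorm_map_le hX hY _) hr₁ hr₂ (isMB_assemble φ) hv hw

lemma mnorm_map_comptMB_le (hr₁ : IsCB r₁) (hr₂ : IsCB r₂) (hs : IsCB s) (n : ℕ)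
    (φ : Matrix (Fin n) (Fin n) (tMB V W X)) :
    mnorm n (φ.map (comptMB hr₁ hr₂ hs)) ≤ cbNorm s * cbNorm r₁ * cbNorm r₂ * mnorm n φ := by
  have h := mnorm_map_compMB_le hr₂ hr₁ hs n (φ.map tMBFlip)
  rw [mul_right_comm (cbNorm s)] at h
  exact h

lemma add_compl₁₂_compr₂ (a b : V →ₗ[ℂ] W →ₗ[ℂ] X) :
    ((a + b).compl₁₂ r₁ r₂).compr₂ s
      = (a.compl₁₂ r₁ r₂).compr₂ s + (b.compl₁₂ r₁ r₂).compr₂ s := by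
  ext
  simp

lemma comp_mem_SMB (hr₁ : IsCB r₁) (hr₂ : IsCB r₂) (hs : IsCB s) {φ : V →ₗ[ℂ] W →ₗ[ℂ] X}
    (hφ : φ ∈ SMB V W X) : (φ.compl₁₂ r₁ r₂).compr₂ s ∈ SMB U₁ U₂ Y := by
  obtain ⟨a, ha, b, hb, rfl⟩ := Submodule.mem_sup.mp hφ
  rw [add_compl₁₂_compr₂]
  exact Submodule.add_mem_sup (compMB hr₁ hr₂ hs ⟨a, ha⟩).2 (comptMB hr₁ hr₂ hs ⟨b, hb⟩).2

lemma smbMatrixNorm_comp_le (hr₁ : IsCB r₁) (hr₂ : IsCB r₂) (hs : IsCB s) {n : ℕ}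
    (φ : Matrix (Fin n) (Fin n) (SMB V W X)) :
    smbMatrixNorm U₁ U₂ Y n (Matrix.of fun i j => ⟨_, comp_mem_SMB hr₁ hr₂ hs (φ i j).2⟩)
      ≤ cbNorm s * smbMatrixNorm V W X n φ * cbNorm r₁ * cbNorm r₂ := by
  have n1 := cbNorm_nonneg (OperatorSpace.isMatSeminorm V) r₁
  have n2 := cbNorm_nonneg (OperatorSpace.isMatSeminorm W) r₂
  have n3 := cbNorm_nonneg (OperatorSpace.isMatSeminorm Y) s
  set C := cbNorm s * cbNorm r₁ * cbNorm r₂ with hC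
  have hC0 : 0 ≤ C := by positivity
  have h : cbNorm s * smbMatrixNorm V W X n φ * cbNorm r₁ * cbNorm r₂
      = smbMatrixNorm V W X n φ * C := by ring
  rw [h]
  refine le_mul_of_forall_pos hC0 fun ε hε => ?_
  obtain ⟨a, b, hab, hle⟩ := exists_l1SumNorm_le φ hε
  have h1 := isMatSeminorm_MB (V := V) (W := W) (X := X)
  have h2 := isMatSeminorm_tMB (V := V) (W := W) (X := X)
  have h3 := isMatSeminorm_MB (V := U₁) (W := U₂) (X := Y)
  have h4 := isMatSeminorm_tMB (V := U₁) (W := U₂) (X := Y)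
  have h5 := l1SumNorm_map_le (E := MB V W X) (F := tMB V W X) (E' := MB U₁ U₂ Y)
    (F' := tMB U₁ U₂ Y) h1 h2 h3 h4 hC0 (mnorm_map_compMB_le hr₁ hr₂ hs)
    (mnorm_map_comptMB_le hr₁ hr₂ hs) a b
  refine (smbMatrixNorm_le (a.map (compMB hr₁ hr₂ hs)) (b.map (comptMB hr₁ hr₂ hs)) ?_).trans
    (h5.trans ?_)
  · intro i j
    change ((φ i j : V →ₗ[ℂ] W →ₗ[ℂ] X).compl₁₂ r₁ r₂).compr₂ s = _
    rw [hab]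
    exact add_compl₁₂_compr₂ _ _
  · rw [mul_comm]
    gcongr

end Comp

/-! ### Transposition -/

lemma flip_add_comm (a b : V →ₗ[ℂ] W →ₗ[ℂ] X) : (a + b).flip = b.flip + a.flip := by
  ext
  simp [add_comm]

lemma flip_mem_SMB {φ : V →ₗ[ℂ] W →ₗ[ℂ] X} (hφ : φ ∈ SMB V W X) : φ.flip ∈ SMB W V X := by
  obtain ⟨a, ha, b, hb, rfl⟩ := Submodule.mem_sup.mp hφ
  rw [flip_add_comm]
  exact Submodule.add_mem_sup hb (MBFlip ⟨a, ha⟩).2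

/-- Transposition exchanges `MB` and `ᵗMB` isometrically at every matrix level, and the `ℓ₁`-norm is
symmetric in its summands. Equality follows by exchanging `φ` and `ψ`. -/
lemma smbMatrixNorm_flip_le {n : ℕ} (φ : Matrix (Fin n) (Fin n) (SMB V W X))
    (ψ : Matrix (Fin n) (Fin n) (SMB W V X))
    (h : ∀ i j, (ψ i j : W →ₗ[ℂ] V →ₗ[ℂ] X) = (φ i j : V →ₗ[ℂ] W →ₗ[ℂ] X).flip) :
    smbMatrixNorm W V X n ψ ≤ smbMatrixNorm V W X n φ := by
  refine le_smbMatrixNorm fun a b hab => ?_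
  have h1 := isMatSeminorm_MB (V := V) (W := W) (X := X)
  have h2 := isMatSeminorm_tMB (V := V) (W := W) (X := X)
  have h3 := isMatSeminorm_MB (V := W) (W := V) (X := X)
  have h4 := isMatSeminorm_tMB (V := W) (W := V) (X := X)
  have h5 := l1SumNorm_map_le (E := tMB V W X) (F := MB V W X) (E' := MB W V X)
    (F' := tMB W V X) (A := tMBFlip) (B := MBFlip) h2 h1 h3 h4 zero_le_one
    (fun n x => by rw [one_mul, mnorm_tMB x]) (fun n x => by rw [one_mul, mnorm_map_MBFlip x]) b a
  rw [one_mul] at h5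
  refine (smbMatrixNorm_le (b.map tMBFlip) (a.map MBFlip) ?_).trans
    (h5.trans (l1SumNorm_swap_le (E := MB V W X) (F := tMB V W X) h1 h2 a b))
  intro i j
  rw [h, hab, flip_add_comm]
  rfl

end Ideal

end OpSp

end

theorem mainTheorem11 :
    OpSp.BilinearAssignment.IsOperatorSpaceIdeal OpSp.smbAssignment.{u} ∧
      OpSp.BilinearAssignment.IsSymmetric OpSp.smbAssignment.{u} := by
  refine ⟨⟨?_, ?_, ?_, ?_, ?_⟩, ?_⟩
  · intro V W X _ _ _ _ _ _ φ hφ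
    exact OpSp.isJCB_of_mem_SMB hφ
  · intro V W X _ _ _ _ _ _
    exact OpSp.finiteType_le_SMB
  · intro V W X _ _ _ _ _ _
    exact OpSp.isOperatorSpaceNorm_smbMatrixNorm
  · intro V W X _ _ _ _ _ _ n φ
    exact OpSp.jcbMatrixNorm_le_smbMatrixNorm φ
  · intro V W X U₁ U₂ Y _ _ _ _ _ _ _ _ _ _ _ _ n φ r₁ r₂ s hr₁ hr₂ hs
    exact ⟨fun i j => OpSp.comp_mem_SMB hr₁ hr₂ hs (φ i j).2,
      OpSp.smbMatrixNorm_comp_le hr₁ hr₂ hs φ⟩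
  · intro V W X _ _ _ _ _ _ φ
    exact ⟨OpSp.flip_mem_SMB φ.2, le_antisymm
      (OpSp.smbMatrixNorm_flip_le _ _ fun _ _ => rfl)
      (OpSp.smbMatrixNorm_flip_le _ _ fun _ _ => rfl)⟩
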